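/- Let $H$ and $U$ be real separable Hilbert spaces, let $A$ be a densely defined linear operator on $H$ generating a strongly continuous semigroup $(S(t))_{t\ge 0}$ with $\|S(t)x\|\le M e^{\omega t}\|x\|$ for some $M\ge 1$, $\omega\in\mathbb R$, let $Q^{1/2}:U\to H$ be a Hilbert–Schmidt operator, let $W$ be a cylindrical Wiener process on $U$ (that is, $W_t=\sum_k B^k_t f_k$ with $(f_k)$ an orthonormal basis of $U$ and $(B^k)$ independent standard Brownian motions), and let $u_0\in H$ be deterministic. Let $u$ be the mild solution $$u(t)=S(t)u_0+\int_0^t S(t-s)Q^{1/2}\,dW_s$$ of $du=Au\,dt+Q^{1/2}dW_t$, $u(0)=u_0$. Fix $T>0$, put $$\gamma=\int_0^T S(s)Q^{1/2}(Q^{1/2})^*S(s)^*\,ds ,$$ and let $\mu$ be the law of $u(T)$ on $H$ and $m=S(T)u_0$. Assume that $\gamma$ is injective. Then the following hold. 1. $u(T)$ belongs to the Malliavin–Sobolev space $\mathbb D^{1,2}(H)$ with Malliavin derivative $D_ru(T)=S(T-r)Q^{1/2}$, $r\in[0,T]$, and $\gamma=\int_0^T D_ru(T)\,(D_ru(T))^*\,dr$,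 so $\gamma$ is the Malliavin covariance operator of $u(T)$. 2. For every $h\in\operatorname{Ran}(\gamma^{1/2})$ the score of $\mu$ in the direction $h$ exists and is $$\nabla_h\log p_{u(T)}(u)=-\big\langle\gamma^\dagger(u-S(T)u_0),\,h\big\rangle_H\qquad\text{for }\mu\text{-a.e. }u\in H .$$ Here the two sides have the following meaning. Right-hand side: $\gamma^\dagger$ is the Moore–Penrose pseudoinverse of $\gamma$, a possibly unbounded operator with domain $\operatorname{Ran}\gamma\oplus(\operatorname{Ran}\gamma)^\perp$ (equal to $\operatorname{Ran}\gamma$, since $\gamma$ is injective). The pairing is the element of $L^2(\mu)$ that equals $\langle u-m,\gamma^\dagger h\rangle$ for $h\in\operatorname{Ran}\gamma$ and is extended to $h\in\operatorname{Ran}(\gamma^{1/2})$ by continuity: whenever $h_n\in\operatorname{Ran}\gamma$ and $\gamma^{-1/2}h_n\to\gamma^{-1/2}h$ in $H$, the functions $u\mapsto\langle u-m,\gamma^\dagger h_n\rangle$ converge to it in $L^2(\mu)$ (and such $h_n$ exist). For $\mu$-a.e. $u$ such that $u-m$ is in the domain of $\gamma^\dagger$, it is equal to $\langle\gamma^\dagger(u-m),h\rangle$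 literally. Left-hand side: a function $\beta\in L^1(\mu)$ is the score $\nabla_h\log p_{u(T)}$ if * for every $s\in\mathbb R$ the translated measure $B\mapsto\mu(B+sh)$ has a strictly positive density $\rho_s$ with respect to $\mu$ (playing the role of $p(u+sh)/p(u)$), with $\rho_s(u)$ measurable in $u$ and continuous in $s$, such that $\frac{d}{ds}\big|_{s=0}\log\rho_s(u)=\beta(u)$ for $\mu$-a.e. $u$; and * $\frac{d}{ds}\big|_{s=0}\mu(B+sh)=\int_B\beta\,d\mu$ for every Borel set $B\subset H$. -/

import Mathlib

open MeasureTheory ProbabilityTheory Filter Topology Set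
open scoped NNReal ENNReal RealInnerProductSpace InnerProduct

noncomputable section

namespace LinearSPDE

/-! ### Strongly continuous semigroups and their generators -/

/-- `S` is a strongly continuous semigroup of bounded operators. -/
structure IsC0Semigroup {H : Type*} [NormedAddCommGroup H] [NormedSpace ℝ H]
    (S : ℝ≥0 → H →L[ℝ] H) : Prop where
  map_zero : S 0 = ContinuousLinearMap.id ℝ H
  map_add : ∀ s t, S (s + t) = (S s).comp (S t)
  continuous_apply : ∀ x, Continuous fun t => S t x

/-- The unbounded operator `A` is the infinitesimal generator of `S`: its domain is the set of all
`x` for which `(S t x - x) / t` converges as `t ↓ 0`, and `A x` is the limit. -/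
def IsGenerator {H : Type*} [NormedAddCommGroup H] [NormedSpace ℝ H]
    (A : H →ₗ.[ℝ] H) (S : ℝ≥0 → H →L[ℝ] H) : Prop :=
  ∀ x y : H, (x, y) ∈ A.graph ↔
    Tendsto (fun t : ℝ≥0 => (t : ℝ)⁻¹ • (S t x - x)) (𝓝[>] 0) (𝓝 y)

/-! ### Cylindrical Wiener process and stochastic integrals of deterministic integrands -/

section Wiener

variable {Ω : Type*} [MeasurableSpace Ω]

/-- The coordinates of a cylindrical Wiener process with respect to an orthonormal basis indexed
by `ι`: independent standard real Brownian motions. -/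
structure IsCylindricalWiener {ι : Type*} (P : Measure Ω) (B : ι → ℝ≥0 → Ω → ℝ) : Prop where
  measurable : ∀ k t, Measurable (B k t)
  brownian : ∀ k, IsBrownianReal (B k) P
  indep : iIndepFun (fun k ω t => B k t ω) P

variable {E : Type*} [NormedAddCommGroup E] [NormedSpace ℝ E]

/-- The step function `∑ i < n, a i • 1_{(t i, t (i+1)]}`. -/
def stepFun (n : ℕ) (t : ℕ → ℝ≥0) (a : ℕ → E) (s : ℝ) : E :=
  ∑ i ∈ Finset.range n, (Ioc (t i : ℝ) (t (i + 1))).indicator (fun _ => a i) s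

/-- The integral `∑ i < n, (B (t (i+1)) - B (t i)) • a i` of a step function against `B`. -/
def stepIntegral (B : ℝ≥0 → Ω → ℝ) (n : ℕ) (t : ℕ → ℝ≥0) (a : ℕ → E) (ω : Ω) : E :=
  ∑ i ∈ Finset.range n, (B (t (i + 1)) ω - B (t i) ω) • a i

/-- `X = ∫₀ᵀ φ(s) dB(s)` for a deterministic integrand `φ ∈ L²([0,T]; E)` and a real Brownian
motion `B`: `X` is the `L²(Ω; E)`-limit of the integrals of step functions that converge to `φ`
in `L²([0,T]; E)`. -/
def IsWienerIntegral (P : Measure Ω) (B : ℝ≥0 → Ω → ℝ) (T : ℝ≥0) (φ : ℝ → E) (X : Ω → E) : Prop :=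
  MemLp φ 2 (volume.restrict (Ioc (0 : ℝ) T)) ∧ AEStronglyMeasurable X P ∧
  ∃ (n : ℕ → ℕ) (t : ℕ → ℕ → ℝ≥0) (a : ℕ → ℕ → E),
    (∀ m, Monotone (t m) ∧ ∀ i, t m i ≤ T) ∧
    Tendsto (fun m => eLpNorm (fun s => φ s - stepFun (n m) (t m) (a m) s) 2
      (volume.restrict (Ioc (0 : ℝ) T))) atTop (𝓝 0) ∧
    Tendsto (fun m => eLpNorm (fun ω => X ω - stepIntegral B (n m) (t m) (a m) ω) 2 P)
      atTop (𝓝 0)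

variable {ι : Type*} {U : Type*} [NormedAddCommGroup U] [InnerProductSpace ℝ U]

/-- `X = ∫₀ᵀ Φ(s) dW_s = ∑ₖ ∫₀ᵀ Φ(s) fₖ dBₖ(s)`, the series converging in `L²(Ω; E)`, where
`W = ∑ₖ Bₖ fₖ` is the cylindrical Wiener process with coordinates `Bₖ` in the orthonormal basis
`fₖ` of `U`. -/
def IsStochasticIntegral (P : Measure Ω) (f : HilbertBasis ι ℝ U) (B : ι → ℝ≥0 → Ω → ℝ)
    (T : ℝ≥0) (Φ : ℝ → U →L[ℝ] E) (X : Ω → E) : Prop :=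
  AEStronglyMeasurable X P ∧
  ∃ I : ι → Ω → E, (∀ k, IsWienerIntegral P (B k) T (fun s => Φ s (f k)) (I k)) ∧
    Tendsto (fun F : Finset ι => eLpNorm (fun ω => X ω - ∑ k ∈ F, I k ω) 2 P) atTop (𝓝 0)

end Wiener

section SPDE

variable {Ω : Type*} [MeasurableSpace Ω] {ι : Type*}
  {U : Type*} [NormedAddCommGroup U] [InnerProductSpace ℝ U]
  {H : Type*} [NormedAddCommGroup H] [InnerProductSpace ℝ H]

/-- `u` is the mild solution of `du = A u dt + G dW`, `u(0) = u₀`, where `S` is the semigroup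
generated by `A` and `G = Q^{1/2}`: for every `t ≥ 0`, almost surely
`u(t) = S(t) u₀ + ∫₀ᵗ S(t-s) G dW_s`. -/
def IsMildSolution (P : Measure Ω) (f : HilbertBasis ι ℝ U) (B : ι → ℝ≥0 → Ω → ℝ)
    (S : ℝ≥0 → H →L[ℝ] H) (G : U →L[ℝ] H) (u₀ : H) (u : ℝ≥0 → Ω → H) : Prop :=
  ∀ t : ℝ≥0, ∃ X : Ω → H,
    IsStochasticIntegral P f B t (fun s => (S (t - s.toNNReal)).comp G) X ∧
    ∀ᵐ ω ∂P, u t ω = S t u₀ + X ω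

/-! ### Malliavin derivative and Malliavin covariance operator -/

/-- `F` is the smooth cylindrical `H`-valued random variable
`∑ i, φ i (W(g 0), …, W(g (n-1))) • x i`, where `W(g) = ∫₀ᵀ ⟨g(s), dW_s⟩` and the `φ i` are smooth
functions whose derivatives of all orders have polynomial growth, and `DF` is its Malliavin
derivative `D_r F = ∑ i, ∑ k, ∂ₖ(φ i)(W(g 0), …, W(g (n-1))) • (x i ⊗ g k (r))`, as an operator
from `U` to `H`. -/
def IsSmoothCylindrical (P : Measure Ω) (f : HilbertBasis ι ℝ U) (B : ι → ℝ≥0 → Ω → ℝ)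
    (T : ℝ≥0) (F : Ω → H) (DF : ℝ → Ω → U →L[ℝ] H) : Prop :=
  ∃ (n d : ℕ) (g : Fin n → ℝ → U) (Wg : Fin n → Ω → ℝ) (φ : Fin d → (Fin n → ℝ) → ℝ)
    (x : Fin d → H),
    (∀ k, MemLp (g k) 2 (volume.restrict (Ioc (0 : ℝ) T))) ∧
    (∀ k, IsStochasticIntegral P f B T (fun s => innerSL ℝ (g k s)) (Wg k)) ∧
    (∀ i, (φ i).HasTemperateGrowth) ∧
    (∀ ω, F ω = ∑ i, φ i (fun k => Wg k ω) • x i) ∧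
    (∀ r ω, DF r ω = ∑ i, ((fderiv ℝ (φ i) (fun k => Wg k ω)).comp
      (ContinuousLinearMap.pi fun k => innerSL ℝ (g k r))).smulRight (x i))

/-- `F` belongs to the Malliavin-Sobolev space `𝔻^{1,2}(H)` over the time interval `[0,T]`, and
`DF` is its Malliavin derivative: the pair `(F, DF)` is a limit of pairs made of a smooth
cylindrical random variable and its derivative, in `L²(Ω; H)` for the first component and in
`L²(Ω × [0,T]; HS(U, H))` for the second. -/
def IsMalliavinDerivative (P : Measure Ω) (f : HilbertBasis ι ℝ U) (B : ι → ℝ≥0 → Ω → ℝ)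
    (T : ℝ≥0) (F : Ω → H) (DF : ℝ → Ω → U →L[ℝ] H) : Prop :=
  AEStronglyMeasurable F P ∧
  (∀ k, AEStronglyMeasurable (fun p : Ω × ℝ => DF p.2 p.1 (f k))
    (P.prod (volume.restrict (Ioc (0 : ℝ) T)))) ∧
  ∃ (Fn : ℕ → Ω → H) (DFn : ℕ → ℝ → Ω → U →L[ℝ] H),
    (∀ n, IsSmoothCylindrical P f B T (Fn n) (DFn n)) ∧
    Tendsto (fun n => eLpNorm (fun ω => Fn n ω - F ω) 2 P) atTop (𝓝 0) ∧
    Tendsto (fun n => ∫⁻ ω, (∫⁻ r in Ioc (0 : ℝ) T,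
      ∑' k, ‖DFn n r ω (f k) - DF r ω (f k)‖ₑ ^ 2) ∂P) atTop (𝓝 0)

variable [CompleteSpace U] [CompleteSpace H]

/-- The operator `γ = ∫₀ᵀ S(s) G G* S(s)* ds`. -/
def covOp (S : ℝ≥0 → H →L[ℝ] H) (G : U →L[ℝ] H) (T : ℝ≥0) : H →L[ℝ] H :=
  ∫ s in (0 : ℝ)..T,
    ((S s.toNNReal).comp G).comp (G.adjoint.comp (S s.toNNReal).adjoint)

/-- The Malliavin covariance operator `∫₀ᵀ D_r (D_r)* dr` belonging to a deterministic Malliavin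
derivative `r ↦ D_r`. -/
def malliavinCov (T : ℝ≥0) (D : ℝ → U →L[ℝ] H) : H →L[ℝ] H :=
  ∫ r in (0 : ℝ)..T, (D r).comp (D r).adjoint

end SPDE

/-! ### Square root and Moore-Penrose pseudoinverse -/

section Operators

variable {H : Type*} [NormedAddCommGroup H] [InnerProductSpace ℝ H]

/-- `R` is the (unique) positive square root of `γ`. -/
def IsPosSqrt (γ R : H →L[ℝ] H) : Prop := R.IsPositive ∧ R.comp R = γ

/-- The graph of the Moore-Penrose pseudoinverse of `γ`: `y = γ† x` iff `y ⟂ ker γ` and `γ y` is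
the orthogonal projection of `x` onto the closure of the range of `γ`. -/
def pinvGraph (γ : H →L[ℝ] H) : Submodule ℝ (H × H) where
  carrier := {p | p.2 ∈ γ.kerᗮ ∧ p.1 - γ p.2 ∈ γ.rangeᗮ}
  zero_mem' := by simp
  add_mem' := by
    rintro ⟨a, b⟩ ⟨c, d⟩ ⟨h1, h2⟩ ⟨h3, h4⟩
    refine ⟨Submodule.add_mem _ h1 h3, ?_⟩
    have h := Submodule.add_mem _ h2 h4
    have e : a - γ b + (c - γ d) = (a + c) - γ (b + d) := by rw [map_add]; abel
    exact e ▸ h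
  smul_mem' := by
    rintro c ⟨a, b⟩ ⟨h1, h2⟩
    refine ⟨Submodule.smul_mem _ c h1, ?_⟩
    have h := Submodule.smul_mem _ c h2
    have e : c • (a - γ b) = c • a - γ (c • b) := by rw [map_smul, smul_sub]
    exact e ▸ h

/-- The Moore-Penrose pseudoinverse `γ†`, a possibly unbounded operator with domain
`Ran γ ⊕ (Ran γ)ᗮ`. -/
def pinv (γ : H →L[ℝ] H) : H →ₗ.[ℝ] H := (pinvGraph γ).toLinearPMap

lemma graph_pinv (γ : H →L[ℝ] H) : (pinv γ).graph = pinvGraph γ := by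
  refine Submodule.toLinearPMap_graph_eq _ ?_
  rintro ⟨x, y⟩ ⟨h1, h2⟩ (rfl : x = 0)
  have h3 : γ y = 0 := by
    have h4 : inner ℝ (γ y) ((0 : H) - γ y) = 0 := h2 _ ⟨y, rfl⟩
    rw [zero_sub, inner_neg_right, neg_eq_zero] at h4
    exact inner_self_eq_zero.mp h4
  exact inner_self_eq_zero.mp (h1 y h3)

lemma mem_graph_pinv (γ : H →L[ℝ] H) (x y : H) :
    (x, y) ∈ (pinv γ).graph ↔ y ∈ γ.kerᗮ ∧ x - γ y ∈ γ.rangeᗮ := by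
  rw [graph_pinv]; rfl

/-- `hₙ → h` in the norm `‖γ^{-1/2} ·‖` of the Cameron-Martin space `Ran γ^{1/2}` (for injective
`γ`). -/
def CMTendsto (γ : H →L[ℝ] H) (hn : ℕ → H) (h : H) : Prop :=
  ∃ (R : H →L[ℝ] H) (kn : ℕ → H) (k : H), IsPosSqrt γ R ∧ (∀ n, R (kn n) = hn n) ∧ R k = h ∧
    Tendsto kn atTop (𝓝 k)

/-! ### The pairing `⟨γ†(u - m), h⟩` and the score -/

variable [MeasurableSpace H]

/-- `ℓ(u) = ⟨γ†(u - m), h⟩` as an element of `L²(μ)`, for `h ∈ Ran γ^{1/2}`. For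
`h ∈ dom γ† = Ran γ` (with `γ` injective) this is `⟨u - m, γ† h⟩`; it is extended to
`h ∈ Ran γ^{1/2}` by continuity with respect to the Cameron-Martin norm, the values converging in
`L²(μ)`. -/
structure IsPinvPairing (γ : H →L[ℝ] H) (μ : Measure H) (m h : H) (ℓ : H → ℝ) : Prop where
  memLp : MemLp ℓ 2 μ
  exists_approx : ∃ hn : ℕ → (pinv γ).domain, CMTendsto γ (fun n => (hn n : H)) h
  tendsto : ∀ hn : ℕ → (pinv γ).domain, CMTendsto γ (fun n => (hn n : H)) h →
    Tendsto (fun n => eLpNorm (fun u => ⟪u - m, pinv γ (hn n)⟫ - ℓ u) 2 μ) atTop (𝓝 0)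

/-- `β = ∇_h log p` is the score (logarithmic derivative along `h`) of the measure `μ` with
"density `p`".

* `density`: for all real `s`, the translate `B ↦ μ(B + s h)` has a positive density `ρ s` with
  respect to `μ`, which stands for `u ↦ p(u + s h) / p(u)`, it is continuous in `s`, and
  the derivative of `s ↦ log (ρ s u)` at `0` is `β u`, for `μ`-almost every `u`.
* `deriv`: the derivative of `μ` along `h` exists, `d/ds μ(B + s h) = ∫_B β dμ` at `s = 0` for all
  measurable sets `B`; that is, the derivative of `μ` along `h` has density `β` relative to `μ`. -/
structure IsScore (μ : Measure H) (h : H) (β : H → ℝ) : Prop where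
  integrable : Integrable β μ
  density : ∃ ρ : ℝ → H → ℝ, (∀ s, Measurable (ρ s)) ∧ (∀ s u, 0 < ρ s u) ∧
    (∀ u, Continuous fun s => ρ s u) ∧
    (∀ s : ℝ, μ.map (fun u => u - s • h) = μ.withDensity fun u => ENNReal.ofReal (ρ s u)) ∧
    ∀ᵐ u ∂μ, HasDerivAt (fun s => Real.log (ρ s u)) (β u) 0
  deriv : ∀ B : Set H, MeasurableSet B →
    HasDerivAt (fun s : ℝ => μ.real ((fun u => u - s • h) ⁻¹' B)) (∫ u in B, β u ∂μ) 0

end Operators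

end LinearSPDE

end

/-! Put `m = S T u₀` and `D_r = S(T - r) G`. For fixed `y` the real variable `⟨u(T) - m, y⟩` is a
Wiener integral, an `L²`-limit of finite sums of independent Gaussian increments. Its characteristic
function is therefore determined by its variance, which Parseval turns into `∑ₖ ∫ ⟨D_r fₖ, y⟩² dr =
∫ ‖D_r* y‖² dr = ⟨γ y, y⟩`. With `R = γ^{1/2}` the law `μ` is Gaussian with mean `m` and covariance
`R²` (`IsStochasticIntegral.integral_cexp`, `hasSum_integral_sq_inner_malliavinCov`).

Consequently `R y ↦ ⟨· - m, y⟩` is isometric into `L²(μ)`. As `γ` is injective, `R` has dense range,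
so every `h = R k` yields a Paley-Wiener functional `ℓ` (`exists_paleyWiener`), and `ℓ` is the
pairing `⟨γ†(· - m), h⟩`. By Cameron-Martin (`map_sub_smul_eq_withDensity`) the translate of `μ` by
`-s h` has density `exp(-s ℓ - s² ‖k‖² / 2)`; differentiating at `s = 0`, pointwise and under the
integral, gives the score `-ℓ` (`isScore`).

For the Malliavin derivative, replacing the integrand by step functions on finitely many basis
directions gives an affine function of Brownian increments, whose derivative is the step integrand
itself. Both converge: the variables in `L²(Ω; H)`, the derivatives in Hilbert-Schmidt norm
(`IsStochasticIntegral.isMalliavinDerivative`). -/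

namespace LinearSPDE

/-! ### Characteristic functions and their `L²`-continuity. -/

section CharFun

variable {Ω : Type*} [MeasurableSpace Ω] {P : Measure Ω}

lemma integral_cexp_of_hasLaw_gaussianReal {Y : Ω → ℝ} {v : ℝ≥0}
    (hY : HasLaw Y (gaussianReal 0 v) P) (c : ℝ) :
    ∫ ω, Complex.exp (((Y ω * c : ℝ) : ℂ) * Complex.I) ∂P =
      Complex.exp ((-(v * c ^ 2) / 2 : ℝ) : ℂ) := by
  have h := charFun_gaussianReal (μ := 0) (v := v) c
  rw [← hY.map_eq, charFun_apply, integral_map hY.aemeasurable (by fun_prop)] at h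
  simp only [RCLike.inner_apply, conj_trivial] at h
  simp only [mul_comm (Y _) c]
  rw [h]
  congr 1
  push_cast
  ring

/-- The characteristic function at `1` is continuous with respect to the `L²` seminorm. -/
lemma enorm_integral_cexp_sub_le [IsProbabilityMeasure P] {X Y : Ω → ℝ}
    (hX : AEStronglyMeasurable X P) (hY : AEStronglyMeasurable Y P) :
    ‖∫ ω, Complex.exp (X ω * Complex.I) ∂P - ∫ ω, Complex.exp (Y ω * Complex.I) ∂P‖ₑ ≤
      eLpNorm (fun ω => X ω - Y ω) 2 P := by
  have hi : ∀ {Z : Ω → ℝ}, AEStronglyMeasurable Z P →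
      Integrable (fun ω => Complex.exp (Z ω * Complex.I)) P := by
    intro Z hZ
    refine Integrable.of_bound (C := 1) ?_ (ae_of_all _ fun ω => ?_)
    · exact (Complex.continuous_exp.comp
        (Complex.continuous_ofReal.mul continuous_const)).comp_aestronglyMeasurable hZ
    · rw [Complex.norm_exp_ofReal_mul_I]
  rw [← integral_sub (hi hX) (hi hY)]
  refine (enorm_integral_le_lintegral_enorm _).trans ?_
  have h1 : eLpNorm (fun ω => X ω - Y ω) 1 P ≤ eLpNorm (fun ω => X ω - Y ω) 2 P :=
    eLpNorm_le_eLpNorm_of_exponent_le (by norm_num) (hX.sub hY)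
  refine le_trans ?_ h1
  rw [eLpNorm_one_eq_lintegral_enorm]
  refine lintegral_mono fun ω => ?_
  have e : Complex.exp (X ω * Complex.I) - Complex.exp (Y ω * Complex.I) =
      Complex.exp (Y ω * Complex.I) * (Complex.exp (Complex.I * ((X ω - Y ω : ℝ) : ℂ)) - 1) := by
    rw [mul_sub, ← Complex.exp_add, mul_one]
    congr 2
    push_cast
    ring
  rw [enorm_le_iff_norm_le, e, norm_mul, Complex.norm_exp_ofReal_mul_I, one_mul]
  exact Real.norm_exp_I_mul_ofReal_sub_one_le

lemma tendsto_integral_cexp [IsProbabilityMeasure P] {α : Type*} {l : Filter α}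
    {X : Ω → ℝ} {Y : α → Ω → ℝ}
    (hX : AEStronglyMeasurable X P) (hY : ∀ a, AEStronglyMeasurable (Y a) P)
    (h : Tendsto (fun a => eLpNorm (fun ω => X ω - Y a ω) 2 P) l (𝓝 0)) :
    Tendsto (fun a => ∫ ω, Complex.exp (Y a ω * Complex.I) ∂P) l
      (𝓝 (∫ ω, Complex.exp (X ω * Complex.I) ∂P)) := by
  rw [tendsto_iff_edist_tendsto_0]
  refine tendsto_of_tendsto_of_tendsto_of_le_of_le tendsto_const_nhds h (fun _ => zero_le)
    fun a => ?_
  rw [edist_comm, edist_eq_enorm_sub]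
  exact enorm_integral_cexp_sub_le hX (hY a)

end CharFun

/-! ### Integrals of step functions. -/

section Step

variable {Ω : Type*} [MeasurableSpace Ω] {P : Measure Ω}

lemma integral_cexp_stepIntegral {B : ℝ≥0 → Ω → ℝ} (hB : IsPreBrownianReal B P)
    (n : ℕ) {t : ℕ → ℝ≥0} (ht : Monotone t) (c : ℕ → ℝ) :
    ∫ ω, Complex.exp (stepIntegral B n t c ω * Complex.I) ∂P =
      Complex.exp ((-(∑ i ∈ Finset.range n, ((t (i + 1) : ℝ) - t i) * c i ^ 2) / 2 : ℝ) : ℂ) := by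
  have hind : iIndepFun (fun (i : Fin n) ω => B (t (i + 1)) ω - B (t i) ω) P :=
    (hB.hasIndepIncrements.nat ht).precomp Fin.val_injective
  have hm : ∀ i : Fin n, AEMeasurable (fun ω => B (t (i + 1)) ω - B (t i) ω) P := fun i =>
    (hB.aemeasurable _).sub (hB.aemeasurable _)
  have key := hind.integral_fun_prod_comp (𝕜 := ℂ)
    (X := fun (i : Fin n) ω => B (t (i + 1)) ω - B (t i) ω)
    (f := fun i x => Complex.exp (((x * c i : ℝ) : ℂ) * Complex.I)) hm
    (fun i => Continuous.aestronglyMeasurable (by fun_prop))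
  have e1 : ∀ ω, Complex.exp (stepIntegral B n t c ω * Complex.I) =
      ∏ i : Fin n, Complex.exp ((((B (t (i + 1)) ω - B (t i) ω) * c i : ℝ) : ℂ) * Complex.I) := by
    intro ω
    rw [← Complex.exp_sum, stepIntegral, ← Finset.sum_mul, Finset.sum_range]
    simp
  simp only [e1]
  rw [key]
  have e2 : ∀ i : Fin n,
      ∫ ω, Complex.exp ((((B (t (i + 1)) ω - B (t i) ω) * c i : ℝ) : ℂ) * Complex.I) ∂P =
        Complex.exp ((-(((t (i + 1) : ℝ) - t i) * c i ^ 2) / 2 : ℝ) : ℂ) := by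
    intro i
    have h := integral_cexp_of_hasLaw_gaussianReal (hB.hasLaw_sub (t (i + 1)) (t i)) (c i)
    simp only [Pi.sub_apply] at h
    rw [h]
    congr 4
    have h0 : (t i : ℝ) ≤ t (i + 1) := by exact_mod_cast ht (Nat.le_succ _)
    rw [coe_nndist, Real.dist_eq, abs_of_nonneg]
    · rfl
    · exact sub_nonneg.2 h0
  rw [Finset.prod_congr rfl fun i _ => e2 i, ← Complex.exp_sum, Finset.sum_range]
  congr 1
  push_cast
  rw [← Finset.sum_div, Finset.sum_neg_distrib]

lemma measurable_stepFun {E : Type*} [NormedAddCommGroup E] [NormedSpace ℝ E]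
    (n : ℕ) (t : ℕ → ℝ≥0) (a : ℕ → E) : StronglyMeasurable (stepFun n t a) := by
  unfold stepFun
  refine Finset.stronglyMeasurable_fun_sum _ fun i _ => ?_
  exact stronglyMeasurable_const.indicator measurableSet_Ioc

lemma memLp_stepFun {E : Type*} [NormedAddCommGroup E] [NormedSpace ℝ E]
    (n : ℕ) (t : ℕ → ℝ≥0) (a : ℕ → E) (p : ℝ≥0∞) (s : Set ℝ) :
    MemLp (stepFun n t a) p (volume.restrict s) := by
  unfold stepFun
  refine memLp_finsetSum _ fun i _ => ?_
  refine (memLp_indicator_const p measurableSet_Ioc (a i) (Or.inr ?_)).restrict s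
  simp

lemma stepFun_eq_zero_of_lt {E : Type*} [NormedAddCommGroup E] [NormedSpace ℝ E]
    {n : ℕ} {t : ℕ → ℝ≥0} (ht : Monotone t) (a : ℕ → E) {s : ℝ} (hs : (t n : ℝ) < s) :
    stepFun n t a s = 0 := by
  refine Finset.sum_eq_zero fun i hi => indicator_of_notMem (fun h => ?_) _
  have h1 : t (i + 1) ≤ t n := ht (Finset.mem_range.1 hi)
  have h2 : (t (i + 1) : ℝ) ≤ t n := by exact_mod_cast h1
  exact absurd (h.2.trans h2) (not_le.2 hs)

/-- Monotone nodes make the intervals disjoint, so no cross terms survive. -/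
lemma sq_stepFun (n : ℕ) {t : ℕ → ℝ≥0} (ht : Monotone t) (c : ℕ → ℝ) (s : ℝ) :
    stepFun n t c s ^ 2 = stepFun n t (fun i => c i ^ 2) s := by
  induction n with
  | zero => simp [stepFun]
  | succ n ih =>
    have e : ∀ d : ℕ → ℝ, stepFun (n + 1) t d s =
        stepFun n t d s + (Ioc (t n : ℝ) (t (n + 1))).indicator (fun _ => d n) s := fun d => by
      rw [stepFun, Finset.sum_range_succ, stepFun]
    rw [e, e, ← ih]
    by_cases hs : s ∈ Ioc (t n : ℝ) (t (n + 1))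
    · rw [stepFun_eq_zero_of_lt ht c hs.1, indicator_of_mem hs, indicator_of_mem hs]
      ring
    · rw [indicator_of_notMem hs, indicator_of_notMem hs, add_zero, add_zero]

lemma integral_sq_stepFun (n : ℕ) {t : ℕ → ℝ≥0} (ht : Monotone t) {T : ℝ≥0} (hT : ∀ i, t i ≤ T)
    (c : ℕ → ℝ) :
    ∫ s in Ioc (0 : ℝ) T, stepFun n t c s ^ 2 =
      ∑ i ∈ Finset.range n, ((t (i + 1) : ℝ) - t i) * c i ^ 2 := by
  simp only [sq_stepFun n ht]
  unfold stepFun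
  rw [integral_finsetSum]
  · refine Finset.sum_congr rfl fun i _ => ?_
    have hsub : Ioc (t i : ℝ) (t (i + 1)) ⊆ Ioc (0 : ℝ) T :=
      Ioc_subset_Ioc (t i).2 (by exact_mod_cast hT (i + 1))
    rw [integral_indicator_const _ measurableSet_Ioc, measureReal_restrict_apply measurableSet_Ioc,
      inter_eq_self_of_subset_left hsub, Real.volume_real_Ioc_of_le, smul_eq_mul]
    exact_mod_cast ht (Nat.le_succ i)
  · intro i _
    refine (memLp_one_iff_integrable.1 ?_)
    refine (memLp_indicator_const 1 measurableSet_Ioc (c i ^ 2) (Or.inr ?_)).restrict _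
    simp

lemma measurable_stepIntegral {B : ℝ≥0 → Ω → ℝ} (hB : ∀ t, Measurable (B t))
    {E : Type*} [NormedAddCommGroup E] [NormedSpace ℝ E]
    (n : ℕ) (t : ℕ → ℝ≥0) (a : ℕ → E) : StronglyMeasurable (stepIntegral B n t a) := by
  unfold stepIntegral
  refine Finset.stronglyMeasurable_fun_sum _ fun i _ => ?_
  exact ((hB _).sub (hB _)).stronglyMeasurable.smul_const (a i)

lemma integral_cexp_sum_stepIntegral {ι : Type*} {B : ι → ℝ≥0 → Ω → ℝ}
    (hB : IsCylindricalWiener P B) (F : Finset ι) (n : ι → ℕ) {t : ι → ℕ → ℝ≥0}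
    (ht : ∀ k, Monotone (t k)) {T : ℝ≥0} (hT : ∀ k i, t k i ≤ T) (c : ι → ℕ → ℝ) :
    ∫ ω, Complex.exp ((∑ k ∈ F, stepIntegral (B k) (n k) (t k) (c k) ω : ℝ) * Complex.I) ∂P =
      Complex.exp ((-(∑ k ∈ F, ∫ s in Ioc (0 : ℝ) T, stepFun (n k) (t k) (c k) s ^ 2) / 2 : ℝ) :
        ℂ) := by
  have hind : iIndepFun (fun (k : F) => stepIntegral (B k) (n k) (t k) (c k)) P := by
    -- Independence is assumed for whole paths; each step integral is a measurable functional of one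
    -- path.
    refine (hB.indep.precomp (g := fun k : F => (k : ι)) Subtype.val_injective).comp
      (fun (k : F) (x : ℝ≥0 → ℝ) => ∑ i ∈ Finset.range (n k), (x (t k (i + 1)) - x (t k i)) • c k i)
      fun k => ?_
    fun_prop
  have key := hind.integral_fun_prod_comp (𝕜 := ℂ)
    (X := fun (k : F) => stepIntegral (B k) (n k) (t k) (c k))
    (f := fun _ x => Complex.exp ((x : ℂ) * Complex.I))
    (fun k => (measurable_stepIntegral (hB.measurable k) _ _ _).measurable.aemeasurable)
    (fun i => Continuous.aestronglyMeasurable (by fun_prop))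
  have e1 : ∀ ω, Complex.exp ((∑ k ∈ F, stepIntegral (B k) (n k) (t k) (c k) ω : ℝ) * Complex.I) =
      ∏ k : F, Complex.exp (stepIntegral (B k) (n k) (t k) (c k) ω * Complex.I) := by
    intro ω
    rw [← Complex.exp_sum, ← Finset.sum_mul, ← Finset.sum_coe_sort]
    simp
  simp only [e1]
  rw [key, Finset.prod_congr rfl fun (k : F) _ =>
    integral_cexp_stepIntegral (hB.brownian k).toIsPreBrownianReal (n k) (ht k) (c k),
    ← Complex.exp_sum, ← Finset.sum_coe_sort F]
  congr 1
  simp only [integral_sq_stepFun _ (ht _) (hT _)]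
  push_cast
  rw [← Finset.sum_div, Finset.sum_neg_distrib]

end Step

/-! ### Stochastic integrals commute with bounded operators. -/

section Map

variable {Ω : Type*} [MeasurableSpace Ω] {P : Measure Ω}
  {E : Type*} [NormedAddCommGroup E] [NormedSpace ℝ E]
  {E' : Type*} [NormedAddCommGroup E'] [NormedSpace ℝ E']

lemma map_stepFun (L : E →L[ℝ] E') (n : ℕ) (t : ℕ → ℝ≥0) (a : ℕ → E) (s : ℝ) :
    L (stepFun n t a s) = stepFun n t (fun i => L (a i)) s := by
  simp only [stepFun, map_sum]
  refine Finset.sum_congr rfl fun i _ => ?_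
  by_cases h : s ∈ Ioc (t i : ℝ) (t (i + 1)) <;> simp [h]

lemma map_stepIntegral {Ω' : Type*} (L : E →L[ℝ] E') (B : ℝ≥0 → Ω' → ℝ) (n : ℕ) (t : ℕ → ℝ≥0)
    (a : ℕ → E) (ω : Ω') : L (stepIntegral B n t a ω) = stepIntegral B n t (fun i => L (a i)) ω := by
  simp [stepIntegral]

lemma tendsto_eLpNorm_clm_comp {α β : Type*} [MeasurableSpace β] {μ : Measure β} {l : Filter α}
    {p : ℝ≥0∞} (L : E →L[ℝ] E') {g : α → β → E}
    (h : Tendsto (fun a => eLpNorm (g a) p μ) l (𝓝 0)) :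
    Tendsto (fun a => eLpNorm (fun x => L (g a x)) p μ) l (𝓝 0) := by
  have h2 : Tendsto (fun a => (‖L‖₊ : ℝ≥0∞) * eLpNorm (g a) p μ) l (𝓝 0) := by
    have := ENNReal.Tendsto.const_mul (a := (‖L‖₊ : ℝ≥0∞)) h (Or.inr ENNReal.coe_ne_top)
    rwa [mul_zero] at this
  refine tendsto_of_tendsto_of_tendsto_of_le_of_le tendsto_const_nhds h2 (fun _ => zero_le)
    fun a => ?_
  exact eLpNorm_le_nnreal_smul_eLpNorm_of_ae_le_mul (ae_of_all _ fun x => L.le_opNNNorm _) p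

lemma IsWienerIntegral.clm_comp {B : ℝ≥0 → Ω → ℝ} {T : ℝ≥0} {φ : ℝ → E} {X : Ω → E}
    (h : IsWienerIntegral P B T φ X) (L : E →L[ℝ] E') :
    IsWienerIntegral P B T (fun s => L (φ s)) (fun ω => L (X ω)) := by
  obtain ⟨h1, h2, n, t, a, ht, h3, h4⟩ := h
  refine ⟨L.comp_memLp' h1, L.continuous.comp_aestronglyMeasurable h2, n, t,
    fun m i => L (a m i), ht, ?_, ?_⟩
  · simpa only [map_sub, map_stepFun] using tendsto_eLpNorm_clm_comp L h3
  · simpa only [map_sub, map_stepIntegral] using tendsto_eLpNorm_clm_comp L h4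

lemma IsStochasticIntegral.clm_comp {ι U : Type*} [NormedAddCommGroup U] [InnerProductSpace ℝ U]
    {f : HilbertBasis ι ℝ U} {B : ι → ℝ≥0 → Ω → ℝ} {T : ℝ≥0} {Φ : ℝ → U →L[ℝ] E} {X : Ω → E}
    (h : IsStochasticIntegral P f B T Φ X) (L : E →L[ℝ] E') :
    IsStochasticIntegral P f B T (fun s => L.comp (Φ s)) (fun ω => L (X ω)) := by
  obtain ⟨h1, I, h2, h3⟩ := h
  refine ⟨L.continuous.comp_aestronglyMeasurable h1, fun k ω => L (I k ω),
    fun k => (h2 k).clm_comp L, ?_⟩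
  simpa only [map_sub, map_sum] using tendsto_eLpNorm_clm_comp L h3

end Map

/-! ### Characteristic function of a real stochastic integral. -/

section Gaussian

variable {Ω : Type*} [MeasurableSpace Ω] {P : Measure Ω}

lemma tendsto_integral_sq {α β : Type*} [MeasurableSpace β] {μ : Measure β} {l : Filter α}
    {g : β → ℝ} {gn : α → β → ℝ} (hg : MemLp g 2 μ) (hgn : ∀ a, MemLp (gn a) 2 μ)
    (h : Tendsto (fun a => eLpNorm (fun x => g x - gn a x) 2 μ) l (𝓝 0)) :
    Tendsto (fun a => ∫ x, gn a x ^ 2 ∂μ) l (𝓝 (∫ x, g x ^ 2 ∂μ)) := by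
  have h1 : Tendsto (fun a => (hgn a).toLp (gn a)) l (𝓝 (hg.toLp g)) := by
    rw [Lp.tendsto_Lp_iff_tendsto_eLpNorm'']
    refine h.congr fun a => ?_
    rw [← eLpNorm_neg]
    congr 1
    ext x
    simp
  have h2 := (h1.norm.pow 2)
  have e : ∀ {φ : β → ℝ} (hφ : MemLp φ 2 μ), ‖hφ.toLp φ‖ ^ 2 = ∫ x, φ x ^ 2 ∂μ := by
    intro φ hφ
    rw [← real_inner_self_eq_norm_sq, L2.inner_def]
    refine integral_congr_ae ?_
    filter_upwards [hφ.coeFn_toLp] with x hx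
    simp [hx, sq]
  simpa only [e] using h2

/-- Two limits are taken: step functions approximate the integrand for a fixed finite set of
coordinates, then that set exhausts `ι`. Argument `1` is enough, since any other scalar can be
absorbed into `Φ`. -/
lemma IsStochasticIntegral.integral_cexp [IsProbabilityMeasure P]
    {ι U : Type*} [NormedAddCommGroup U] [InnerProductSpace ℝ U]
    {f : HilbertBasis ι ℝ U} {B : ι → ℝ≥0 → Ω → ℝ} (hB : IsCylindricalWiener P B)
    {T : ℝ≥0} {Φ : ℝ → U →L[ℝ] ℝ} {X : Ω → ℝ} (h : IsStochasticIntegral P f B T Φ X)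
    {σ : ℝ} (hσ : HasSum (fun k => ∫ s in Ioc (0 : ℝ) T, Φ s (f k) ^ 2) σ) :
    ∫ ω, Complex.exp (X ω * Complex.I) ∂P = Complex.exp ((-σ / 2 : ℝ) : ℂ) := by
  obtain ⟨h1, I, h2, h3⟩ := h
  have hfin : ∀ F : Finset ι,
      ∫ ω, Complex.exp ((∑ k ∈ F, I k ω : ℝ) * Complex.I) ∂P =
        Complex.exp ((-(∑ k ∈ F, ∫ s in Ioc (0 : ℝ) T, Φ s (f k) ^ 2) / 2 : ℝ) : ℂ) := by
    intro F
    choose hφ hI n t a ht hst hint using h2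
    have l1 := tendsto_integral_cexp (l := atTop) (P := P) (X := fun ω => ∑ k ∈ F, I k ω)
      (Y := fun m ω => ∑ k ∈ F, stepIntegral (B k) (n k m) (t k m) (a k m) ω)
      (Finset.aestronglyMeasurable_fun_sum _ fun k _ => hI k)
      (fun m => Finset.aestronglyMeasurable_fun_sum _ fun k _ =>
        (measurable_stepIntegral (hB.measurable k) _ _ _).aestronglyMeasurable) ?_
    · have l2 : Tendsto (fun m => Complex.exp ((-(∑ k ∈ F, ∫ s in Ioc (0 : ℝ) T,
          stepFun (n k m) (t k m) (a k m) s ^ 2) / 2 : ℝ) : ℂ)) atTop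
          (𝓝 (Complex.exp ((-(∑ k ∈ F, ∫ s in Ioc (0 : ℝ) T, Φ s (f k) ^ 2) / 2 : ℝ) : ℂ))) := by
        have : Tendsto (fun m => ∑ k ∈ F, ∫ s in Ioc (0 : ℝ) T,
            stepFun (n k m) (t k m) (a k m) s ^ 2) atTop
            (𝓝 (∑ k ∈ F, ∫ s in Ioc (0 : ℝ) T, Φ s (f k) ^ 2)) :=
          tendsto_finsetSum _ fun k _ =>
            tendsto_integral_sq (hφ k) (fun m => memLp_stepFun _ _ _ _ _) (hst k)
        exact (Complex.continuous_exp.tendsto _).comp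
          ((Complex.continuous_ofReal.tendsto _).comp (this.neg.div_const 2))
      refine tendsto_nhds_unique l1 (l2.congr fun m => ?_)
      exact (integral_cexp_sum_stepIntegral hB F (fun k => n k m) (fun k => (ht k m).1)
        (fun k => (ht k m).2) (fun k => a k m)).symm
    · have l3 : Tendsto (fun m => ∑ k ∈ F, eLpNorm (fun ω => I k ω -
          stepIntegral (B k) (n k m) (t k m) (a k m) ω) 2 P) atTop (𝓝 (∑ k ∈ F, 0)) :=
        tendsto_finsetSum _ fun k _ => hint k
      rw [Finset.sum_const_zero] at l3
      refine tendsto_of_tendsto_of_tendsto_of_le_of_le tendsto_const_nhds l3 (fun _ => zero_le)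
        fun m => ?_
      simp only [← Finset.sum_sub_distrib]
      rw [show (fun ω => ∑ k ∈ F, (I k ω - stepIntegral (B k) (n k m) (t k m) (a k m) ω)) =
        ∑ k ∈ F, fun ω => I k ω - stepIntegral (B k) (n k m) (t k m) (a k m) ω by
          ext ω; simp]
      exact eLpNorm_sum_le (fun k _ => (hI k).sub
        (measurable_stepIntegral (hB.measurable k) _ _ _).aestronglyMeasurable) (by norm_num)
  have l1 := tendsto_integral_cexp (P := P) h1
    (fun F : Finset ι => Finset.aestronglyMeasurable_fun_sum F fun k _ => (h2 k).2.1) h3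
  refine tendsto_nhds_unique l1 ?_
  simp only [hfin]
  have hσ' : Tendsto (fun F => ∑ k ∈ F, ∫ s in Ioc (0 : ℝ) T, Φ s (f k) ^ 2) atTop (𝓝 σ) := hσ
  exact (Complex.continuous_exp.tendsto _).comp
    ((Complex.continuous_ofReal.tendsto _).comp (hσ'.neg.div_const 2))

end Gaussian

/-! ### Hilbert-Schmidt operators and the covariance operator. -/

section HilbertSchmidt

variable {ι : Type*}
  {U : Type*} [NormedAddCommGroup U] [InnerProductSpace ℝ U] [CompleteSpace U]
  {H : Type*} [NormedAddCommGroup H] [InnerProductSpace ℝ H] [CompleteSpace H]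

lemma hasSum_sq_inner_apply_basis (f : HilbertBasis ι ℝ U) (A : U →L[ℝ] H) (y : H) :
    HasSum (fun k => ⟪A (f k), y⟫ ^ 2) (‖A.adjoint y‖ ^ 2) := by
  have h := f.hasSum_inner_mul_inner (A.adjoint y) (A.adjoint y)
  rw [real_inner_self_eq_norm_sq] at h
  have e : ∀ k, ⟪A (f k), y⟫ ^ 2 = ⟪A.adjoint y, f k⟫ * ⟪f k, A.adjoint y⟫ := fun k => by
    rw [real_inner_comm (f k), ContinuousLinearMap.adjoint_inner_right, sq]
  simpa only [e] using h

lemma norm_sq_le_tsum_norm_sq_basis (f : HilbertBasis ι ℝ U) (A : U →L[ℝ] H)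
    (hA : Summable fun k => ‖A (f k)‖ ^ 2) : ‖A‖ ^ 2 ≤ ∑' k, ‖A (f k)‖ ^ 2 := by
  have h0 : 0 ≤ ∑' k, ‖A (f k)‖ ^ 2 := tsum_nonneg fun k => sq_nonneg _
  rw [← LinearIsometryEquiv.norm_map ContinuousLinearMap.adjoint A]
  refine (Real.le_sqrt (norm_nonneg _) h0).1 ?_
  refine ContinuousLinearMap.opNorm_le_bound _ (Real.sqrt_nonneg _) fun y => ?_
  refine le_of_sq_le_sq ?_ (by positivity)
  rw [mul_pow, Real.sq_sqrt h0, ← (hasSum_sq_inner_apply_basis f A y).tsum_eq, ← tsum_mul_right]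
  refine (hasSum_sq_inner_apply_basis f A y).summable.tsum_le_tsum (fun k => ?_) (hA.mul_right _)
  rw [← mul_pow, sq_le_sq, abs_of_nonneg (a := ‖A (f k)‖ * ‖y‖) (by positivity)]
  exact abs_real_inner_le_norm _ _

/-- Composition with a Hilbert-Schmidt operator upgrades strong continuity to norm continuity: the
Hilbert-Schmidt norm of the difference tends to zero by dominated convergence over the basis, and it
bounds the operator norm. This makes the operator-valued integrands of `covOp` and `malliavinCov`
Bochner integrable. -/
lemma continuous_comp_of_hilbertSchmidt (f : HilbertBasis ι ℝ U) {X : Type*} [TopologicalSpace X]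
    {S : X → H →L[ℝ] H} (hS : ∀ x, Continuous fun t => S t x)
    (hb : ∀ t, ∃ C : ℝ, ∀ᶠ s in 𝓝 t, ∀ x, ‖S s x‖ ≤ C * ‖x‖)
    (G : U →L[ℝ] H) (hG : Summable fun k => ‖G (f k)‖ ^ 2) :
    Continuous fun t => (S t).comp G := by
  refine continuous_iff_continuousAt.2 fun t => ?_
  rw [ContinuousAt, tendsto_iff_norm_sub_tendsto_zero]
  obtain ⟨C, hC⟩ := hb t
  have hbd : ∀ᶠ s in 𝓝 t, ∀ k, ‖((S s).comp G - (S t).comp G) (f k)‖ ^ 2 ≤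
      (C + C) ^ 2 * ‖G (f k)‖ ^ 2 := by
    filter_upwards [hC] with s hs k
    rw [← mul_pow]
    refine pow_le_pow_left₀ (norm_nonneg _) ?_ 2
    refine (norm_sub_le _ _).trans ?_
    rw [add_mul]
    exact add_le_add (hs _) (hC.self_of_nhds _)
  have hsum : Tendsto (fun s => ∑' k, ‖((S s).comp G - (S t).comp G) (f k)‖ ^ 2) (𝓝 t)
      (𝓝 (∑' _ : ι, (0 : ℝ))) := by
    refine tendsto_tsum_of_dominated_convergence (hG.mul_left ((C + C) ^ 2)) (fun k => ?_) ?_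
    · have h1 : Tendsto (fun s => S s (G (f k))) (𝓝 t) (𝓝 (S t (G (f k)))) := (hS _).tendsto t
      have h2 := (tendsto_iff_norm_sub_tendsto_zero.1 h1).pow 2
      simpa using h2
    · filter_upwards [hbd] with s hs k
      rw [Real.norm_of_nonneg (sq_nonneg _)]
      exact hs k
  rw [tsum_zero] at hsum
  have h2 : Tendsto (fun s => ‖(S s).comp G - (S t).comp G‖ ^ 2) (𝓝 t) (𝓝 0) := by
    refine tendsto_of_tendsto_of_tendsto_of_le_of_le' tendsto_const_nhds hsum
      (Eventually.of_forall fun _ => sq_nonneg _) ?_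
    filter_upwards [hbd] with s hs
    exact norm_sq_le_tsum_norm_sq_basis f _
      (Summable.of_nonneg_of_le (fun _ => sq_nonneg _) hs (hG.mul_left _))
  have h3 := h2.sqrt
  simpa [Real.sqrt_sq (norm_nonneg _)] using h3

lemma continuous_comp_adjoint {X : Type*} [TopologicalSpace X] {D : X → U →L[ℝ] H}
    (hD : Continuous D) : Continuous fun r => (D r).comp (D r).adjoint :=
  hD.clm_comp (ContinuousLinearMap.adjoint.continuous.comp hD)

lemma inner_malliavinCov {D : ℝ → U →L[ℝ] H} (hD : Continuous D) (T : ℝ≥0) (y z : H) :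
    ⟪malliavinCov T D y, z⟫ = ∫ r in Ioc (0 : ℝ) T, ⟪(D r).adjoint y, (D r).adjoint z⟫ := by
  have hc := continuous_comp_adjoint hD
  let L : (H →L[ℝ] H) →L[ℝ] ℝ := (innerSL ℝ z).comp (ContinuousLinearMap.apply ℝ H y)
  have h := L.intervalIntegral_comp_comm (hc.intervalIntegrable 0 T) (μ := volume)
  rw [real_inner_comm, ← intervalIntegral.integral_of_le T.coe_nonneg]
  refine h.symm.trans ?_
  congr 1
  ext r
  simp only [L, ContinuousLinearMap.comp_apply, ContinuousLinearMap.apply_apply, innerSL_apply_apply,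
    ContinuousLinearMap.adjoint_inner_right]
  rw [real_inner_comm]

/-- Parseval for `D_r* y`, integrated in `r`; the summable bound `b` justifies exchanging sum and
integral. -/
lemma hasSum_integral_sq_inner_malliavinCov (f : HilbertBasis ι ℝ U) [Countable ι]
    {D : ℝ → U →L[ℝ] H} (hD : Continuous D)
    (T : ℝ≥0) {b : ι → ℝ} (hb : ∀ r k, ‖D r (f k)‖ ^ 2 ≤ b k) (hbs : Summable b) (y : H) :
    HasSum (fun k => ∫ r in Ioc (0 : ℝ) T, ⟪D r (f k), y⟫ ^ 2) ⟪malliavinCov T D y, y⟫ := by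
  have hc : ∀ k, Continuous fun r => ⟪D r (f k), y⟫ ^ 2 := fun k => by fun_prop
  have hi : ∀ k, Integrable (fun r => ⟪D r (f k), y⟫ ^ 2) (volume.restrict (Ioc (0 : ℝ) T)) :=
    fun k => (hc k).integrableOn_Ioc
  have key := hasSum_integral_of_summable_integral_norm hi ?_
  · rw [inner_malliavinCov hD]
    have e : ∀ r, ⟪(D r).adjoint y, (D r).adjoint y⟫ = ∑' k, ⟪D r (f k), y⟫ ^ 2 := fun r => by
      rw [(hasSum_sq_inner_apply_basis f (D r) y).tsum_eq, real_inner_self_eq_norm_sq]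
    simpa only [e] using key
  · refine Summable.of_nonneg_of_le (fun k => integral_nonneg fun r => norm_nonneg _)
      (fun k => ?_) (hbs.mul_left (T * ‖y‖ ^ 2))
    have h1 : ∫ r in Ioc (0 : ℝ) T, ‖⟪D r (f k), y⟫ ^ 2‖ ≤ ∫ r in Ioc (0 : ℝ) T, b k * ‖y‖ ^ 2 := by
      refine integral_mono (hi k).norm (integrable_const _) fun r => ?_
      simp only [norm_pow, Real.norm_eq_abs]
      refine (pow_le_pow_left₀ (abs_nonneg _) (abs_real_inner_le_norm _ _) 2).trans ?_
      rw [mul_pow]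
      exact mul_le_mul_of_nonneg_right (hb r k) (sq_nonneg _)
    refine h1.trans (le_of_eq ?_)
    simp
    ring

lemma covOp_eq_malliavinCov (S : ℝ≥0 → H →L[ℝ] H) (G : U →L[ℝ] H) (T : ℝ≥0) :
    covOp S G T = malliavinCov T fun r => (S (T - r.toNNReal)).comp G := by
  unfold covOp malliavinCov
  have h := intervalIntegral.integral_comp_sub_left (a := 0) (b := (T : ℝ))
    (fun s : ℝ => ((S s.toNNReal).comp G).comp (G.adjoint.comp (S s.toNNReal).adjoint)) (T : ℝ)
  rw [sub_self, sub_zero] at h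
  rw [← h]
  refine intervalIntegral.integral_congr fun r hr => ?_
  rw [uIcc_of_le T.coe_nonneg] at hr
  -- The real difference and the truncated one agree because `r` lies in `[0, T]`.
  have e : (T - r : ℝ).toNNReal = T - r.toNNReal := by
    have h1 : r.toNNReal ≤ T := Real.toNNReal_le_iff_le_coe.2 hr.2
    ext
    rw [NNReal.coe_sub h1, Real.coe_toNNReal _ hr.1, Real.coe_toNNReal _ (sub_nonneg.2 hr.2)]
  simp only [e, ContinuousLinearMap.adjoint_comp]

lemma norm_semigroup_apply_le_of_le {E : Type*} [NormedAddCommGroup E] [NormedSpace ℝ E]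
    {S : ℝ≥0 → E →L[ℝ] E} {M ω : ℝ} (hM : 0 ≤ M)
    (hb : ∀ (t : ℝ≥0) (x : E), ‖S t x‖ ≤ M * Real.exp (ω * t) * ‖x‖) {t T : ℝ≥0} (ht : t ≤ T)
    (x : E) : ‖S t x‖ ≤ M * Real.exp (|ω| * T) * ‖x‖ := by
  refine (hb t x).trans ?_
  have h1 : ω * t ≤ |ω| * T := by
    have ht' : (t : ℝ) ≤ T := by exact_mod_cast ht
    calc ω * t ≤ |ω| * t := mul_le_mul_of_nonneg_right (le_abs_self _) t.2
      _ ≤ _ := mul_le_mul_of_nonneg_left ht' (abs_nonneg _)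
  gcongr

lemma continuous_semigroup_comp (f : HilbertBasis ι ℝ U) {S : ℝ≥0 → H →L[ℝ] H}
    (hS : IsC0Semigroup S) {M ω : ℝ} (hM : 0 ≤ M)
    (hb : ∀ (t : ℝ≥0) (x : H), ‖S t x‖ ≤ M * Real.exp (ω * t) * ‖x‖)
    (G : U →L[ℝ] H) (hG : Summable fun k => ‖G (f k)‖ ^ 2) :
    Continuous fun t => (S t).comp G := by
  refine continuous_comp_of_hilbertSchmidt f hS.continuous_apply (fun t => ?_) G hG
  refine ⟨M * Real.exp (|ω| * (t + 1 : ℝ≥0)), ?_⟩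
  filter_upwards [eventually_le_nhds (show t < t + 1 by simp)] with s hs x
  exact norm_semigroup_apply_le_of_le hM hb hs x

end HilbertSchmidt

/-! ### Gaussian variables and Gaussian pairs. -/

section RealGaussian

variable {Ω : Type*} [MeasurableSpace Ω] {P : Measure Ω} [IsProbabilityMeasure P]

lemma hasLaw_gaussianReal_of_integral_cexp {X : Ω → ℝ} (hX : AEMeasurable X P) {v : ℝ≥0}
    (h : ∀ t : ℝ, ∫ ω, Complex.exp ((t * X ω : ℝ) * Complex.I) ∂P =
      Complex.exp ((-(t ^ 2 * v) / 2 : ℝ) : ℂ)) :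
    HasLaw X (gaussianReal 0 v) P := by
  refine ⟨hX, ?_⟩
  have := Measure.isProbabilityMeasure_map (μ := P) hX
  refine Measure.ext_of_charFun (funext fun t => ?_)
  rw [charFun_gaussianReal, charFun_apply, integral_map hX (by fun_prop)]
  simp only [RCLike.inner_apply, conj_trivial]
  rw [h t]
  congr 1
  push_cast
  ring

/-- If the joint characteristic function of `(X, Y)` is that of a centred Gaussian pair with
variances `p`, `r` and covariance `c * r`, then it extends to purely imaginary arguments in the
second variable. -/
lemma integral_cexp_add_mul_of_gaussian_pair {X Y : Ω → ℝ} (hX : AEMeasurable X P)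
    (hY : AEMeasurable Y P) {p c : ℝ} {r : ℝ≥0}
    (h : ∀ a b : ℝ, ∫ ω, Complex.exp ((a * X ω + b * Y ω : ℝ) * Complex.I) ∂P =
      Complex.exp ((-(a ^ 2 * p + 2 * a * b * (c * r) + b ^ 2 * r) / 2 : ℝ) : ℂ)) (s : ℝ) :
    ∫ ω, Complex.exp (X ω * Complex.I) * (Real.exp (-s * Y ω) : ℂ) ∂P =
      Complex.exp (((-p / 2 + s ^ 2 * r / 2 : ℝ) : ℂ) - ((s * (c * r) : ℝ) : ℂ) * Complex.I) := by
  have hlaw : HasLaw Y (gaussianReal 0 r) P := hasLaw_gaussianReal_of_integral_cexp hY fun t => by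
    have := h 0 t
    simpa using this
  -- `X - c Y` is uncorrelated with `Y`, hence independent of it by joint Gaussianity. The
  -- expectation then splits into a characteristic function and the complex moment generating
  -- function of `Y` at `i c - s`. Writing the covariance as `c * r` also covers degenerate `Y`.
  have hZ : AEMeasurable (fun ω => X ω - c * Y ω) P := hX.sub (hY.const_mul c)
  have hcZ : ∀ a : ℝ, ∫ ω, Complex.exp ((a * (X ω - c * Y ω) : ℝ) * Complex.I) ∂P =
      Complex.exp ((-(a ^ 2 * (p - c ^ 2 * r)) / 2 : ℝ) : ℂ) := fun a => by
    have := h a (-(a * c))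
    convert this using 5 with ω
    · congr 1
      ring
    · ring
  have hind : IndepFun (fun ω => X ω - c * Y ω) Y P := by
    rw [indepFun_iff_charFun_prod hZ hY]
    intro t
    rw [charFun_apply, charFun_apply, charFun_apply, integral_map (by fun_prop) (by fun_prop),
      integral_map hZ (by fun_prop), integral_map hY (by fun_prop)]
    simp only [WithLp.prod_inner_apply, RCLike.inner_apply, conj_trivial]
    have h1 := hcZ t.ofLp.1
    have h2 := h 0 t.ofLp.2
    simp only [zero_mul, zero_add] at h2
    rw [h1, h2, ← Complex.exp_add]
    have h3 := h t.ofLp.1 (t.ofLp.2 - c * t.ofLp.1)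
    convert h3 using 5
    · congr 1
      ring
    · push_cast
      ring
  have hmul := IndepFun.integral_fun_comp_mul_comp (𝕜 := ℂ) (μ := P)
    (f := fun x : ℝ => Complex.exp ((x : ℂ) * Complex.I))
    (g := fun x : ℝ => Complex.exp ((c * Complex.I - s) * (x : ℂ)))
    hind hZ hY (Continuous.aestronglyMeasurable (by fun_prop))
    (Continuous.aestronglyMeasurable (by fun_prop))
  have hmgf := complexMGF_gaussianReal hlaw.map_eq (c * Complex.I - s)
  rw [complexMGF] at hmgf
  have h1 := hcZ 1
  simp only [one_mul] at h1
  rw [hmgf, h1, ← Complex.exp_add] at hmul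
  convert hmul using 1
  · refine integral_congr_ae (ae_of_all _ fun ω => ?_)
    simp only
    rw [Complex.ofReal_exp, ← Complex.exp_add, ← Complex.exp_add]
    congr 1
    push_cast
    ring
  · congr 1
    push_cast
    linear_combination (-(c : ℂ) ^ 2 * r / 2) * Complex.I_sq

end RealGaussian

/-! ### Gaussian measures on `H` and Paley-Wiener functionals. -/

section GaussianMeasure

lemma tendsto_eLpNorm_inner_sub {H : Type*} [NormedAddCommGroup H] [InnerProductSpace ℝ H]
    [MeasurableSpace H] {μ : Measure H} {m k : H} {R : H →L[ℝ] H} {ℓ : H → ℝ} {y : ℕ → H}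
    (hℓ : ∀ y, eLpNorm (fun v => ⟪v - m, y⟫ - ℓ v) 2 μ = ENNReal.ofReal ‖R y - k‖)
    (hy : Tendsto (fun n => R (y n)) atTop (𝓝 k)) :
    Tendsto (fun n => eLpNorm (fun v => ⟪v - m, y n⟫ - ℓ v) 2 μ) atTop (𝓝 0) := by
  simp only [hℓ]
  have := ENNReal.tendsto_ofReal (tendsto_iff_norm_sub_tendsto_zero.1 hy)
  rwa [ENNReal.ofReal_zero] at this

variable {H : Type*} [NormedAddCommGroup H] [InnerProductSpace ℝ H]
  [MeasurableSpace H] [BorelSpace H] [SecondCountableTopology H]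

/-- `μ` has the characteristic function of the Gaussian measure with mean `m` and covariance
operator `R* R`. -/
def IsGaussianWithSqrtCov (μ : Measure H) (m : H) (R : H →L[ℝ] H) : Prop :=
  ∀ y, ∫ v, Complex.exp (⟪v - m, y⟫ * Complex.I) ∂μ = Complex.exp ((-‖R y‖ ^ 2 / 2 : ℝ) : ℂ)

namespace IsGaussianWithSqrtCov

variable {μ : Measure H} [IsProbabilityMeasure μ] {m : H} {R : H →L[ℝ] H}

lemma hasLaw_inner (hμ : IsGaussianWithSqrtCov μ m R) (y : H) :
    HasLaw (fun v => ⟪v - m, y⟫) (gaussianReal 0 (‖R y‖₊ ^ 2)) μ := by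
  refine hasLaw_gaussianReal_of_integral_cexp (by fun_prop) fun t => ?_
  have h := hμ (t • y)
  simp only [inner_smul_right, map_smul, norm_smul, mul_pow, Real.norm_eq_abs, sq_abs] at h
  rw [h]
  simp

lemma memLp_inner (hμ : IsGaussianWithSqrtCov μ m R) (y : H) :
    MemLp (fun v => ⟪v - m, y⟫) 2 μ := by
  have h := memLp_id_gaussianReal (μ := 0) (v := ‖R y‖₊ ^ 2) 2
  rw [← (hμ.hasLaw_inner y).map_eq, memLp_map_measure_iff (by fun_prop) (by fun_prop)] at h
  exact h

lemma integral_inner_sq (hμ : IsGaussianWithSqrtCov μ m R) (y : H) :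
    ∫ v, ⟪v - m, y⟫ ^ 2 ∂μ = ‖R y‖ ^ 2 := by
  have hl := hμ.hasLaw_inner y
  have h0 : ∫ v, ⟪v - m, y⟫ ∂μ = 0 := by
    rw [hl.integral_eq, integral_id_gaussianReal]
  have h := hl.variance_eq
  rw [variance_id_gaussianReal, variance_of_integral_eq_zero hl.aemeasurable h0] at h
  simpa using h

/-- The isometry `R y ↦ ⟪· - m, y⟫`, before completion. -/
noncomputable def toLpMap (hμ : IsGaussianWithSqrtCov μ m R) (y : H) : Lp ℝ 2 μ :=
  (hμ.memLp_inner y).toLp _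

lemma norm_toLpMap_sub (hμ : IsGaussianWithSqrtCov μ m R) (y z : H) :
    ‖hμ.toLpMap y - hμ.toLpMap z‖ = ‖R y - R z‖ := by
  have e : hμ.toLpMap y - hμ.toLpMap z = hμ.toLpMap (y - z) := by
    unfold toLpMap
    rw [← MemLp.toLp_sub]
    congr 1
    ext v
    simp [inner_sub_right]
  have h : ‖hμ.toLpMap (y - z)‖ ^ 2 = ‖R (y - z)‖ ^ 2 := by
    rw [← hμ.integral_inner_sq, ← real_inner_self_eq_norm_sq, L2.inner_def]
    refine integral_congr_ae ?_
    filter_upwards [(hμ.memLp_inner (y - z)).coeFn_toLp] with v hv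
    rw [toLpMap, hv]
    simp [sq]
  rw [e, ← map_sub]
  exact (pow_left_inj₀ (norm_nonneg _) (norm_nonneg _) two_ne_zero).1 h

/-- The Paley-Wiener functional belonging to `k` in the closure of the range of `R`. -/
lemma exists_paleyWiener (hμ : IsGaussianWithSqrtCov μ m R) {k : H} (hk : k ∈ closure (range R)) :
    ∃ ℓ : H → ℝ, Measurable ℓ ∧ MemLp ℓ 2 μ ∧
      ∀ y, eLpNorm (fun v => ⟪v - m, y⟫ - ℓ v) 2 μ = ENNReal.ofReal ‖R y - k‖ := by
  obtain ⟨x, hx, hxk⟩ := mem_closure_iff_seq_limit.1 hk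
  choose y hy using hx
  have hyk : Tendsto (fun n => R (y n)) atTop (𝓝 k) := by simpa only [hy] using hxk
  -- The isometry carries the convergent sequence `R (y n)` to a Cauchy sequence in `L²(μ)`.
  have hcauchy : CauchySeq fun n => hμ.toLpMap (y n) := by
    refine Metric.cauchySeq_iff'.2 fun ε hε => ?_
    obtain ⟨N, hN⟩ := Metric.cauchySeq_iff'.1 hyk.cauchySeq ε hε
    refine ⟨N, fun n hn => ?_⟩
    have := hN n hn
    rw [dist_eq_norm] at this ⊢
    rwa [hμ.norm_toLpMap_sub]
  obtain ⟨L, hL⟩ := cauchySeq_tendsto_of_complete hcauchy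
  refine ⟨L, (Lp.stronglyMeasurable L).measurable, Lp.memLp L, fun z => ?_⟩
  have h1 : ‖hμ.toLpMap z - L‖ = ‖R z - k‖ := by
    refine tendsto_nhds_unique ((tendsto_const_nhds.sub hL).norm) ?_
    simp only [norm_toLpMap_sub]
    exact (tendsto_const_nhds.sub hyk).norm
  rw [← h1, Lp.norm_def, ENNReal.ofReal_toReal (Lp.eLpNorm_ne_top _)]
  refine eLpNorm_congr_ae ?_
  filter_upwards [Lp.coeFn_sub (hμ.toLpMap z) L, (hμ.memLp_inner z).coeFn_toLp] with v h2 h3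
  rw [h2, Pi.sub_apply, toLpMap, h3]

variable {k : H} {ℓ : H → ℝ}

/-- With `R (z n) → k`, the exponent is the `L²`-limit of `⟨v - m, y + b • z n⟩`. Rescaling `y`
yields the joint characteristic function of `⟨· - m, y⟩` and `ℓ`. -/
lemma integral_cexp_inner_add_paleyWiener (hμ : IsGaussianWithSqrtCov μ m R)
    (hk : k ∈ closure (range R)) (hm : Measurable ℓ)
    (hℓ : ∀ y, eLpNorm (fun v => ⟪v - m, y⟫ - ℓ v) 2 μ = ENNReal.ofReal ‖R y - k‖)
    (y : H) (b : ℝ) :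
    ∫ v, Complex.exp ((⟪v - m, y⟫ + b * ℓ v : ℝ) * Complex.I) ∂μ =
      Complex.exp ((-‖R y + b • k‖ ^ 2 / 2 : ℝ) : ℂ) := by
  obtain ⟨x, hx, hxk⟩ := mem_closure_iff_seq_limit.1 hk
  choose z hz using hx
  have hzk : Tendsto (fun n => R (z n)) atTop (𝓝 k) := by simpa only [hz] using hxk
  have l1 := tendsto_integral_cexp (P := μ) (l := atTop)
    (X := fun v => ⟪v - m, y⟫ + b * ℓ v) (Y := fun n v => ⟪v - m, y + b • z n⟫)
    (Measurable.aestronglyMeasurable (by fun_prop))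
    (fun n => Continuous.aestronglyMeasurable (by fun_prop)) ?_
  · simp only [hμ (y + b • z _)] at l1
    refine tendsto_nhds_unique l1 ?_
    have l2 : Tendsto (fun n => R (y + b • z n)) atTop (𝓝 (R y + b • k)) := by
      simp only [map_add, map_smul]
      exact tendsto_const_nhds.add (hzk.const_smul b)
    exact (Complex.continuous_exp.tendsto _).comp
      ((Complex.continuous_ofReal.tendsto _).comp ((l2.norm.pow 2).neg.div_const 2))
  · have l2 := tendsto_eLpNorm_clm_comp (ContinuousLinearMap.lsmul ℝ ℝ (-b))
      (tendsto_eLpNorm_inner_sub hℓ hzk)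
    refine l2.congr fun n => ?_
    congr 1
    ext v
    simp [inner_add_right, inner_smul_right]
    ring

lemma hasLaw_paleyWiener (hμ : IsGaussianWithSqrtCov μ m R)
    (hk : k ∈ closure (range R)) (hm : Measurable ℓ)
    (hℓ : ∀ y, eLpNorm (fun v => ⟪v - m, y⟫ - ℓ v) 2 μ = ENNReal.ofReal ‖R y - k‖) :
    HasLaw ℓ (gaussianReal 0 (‖k‖₊ ^ 2)) μ := by
  refine hasLaw_gaussianReal_of_integral_cexp hm.aemeasurable fun t => ?_
  have h := hμ.integral_cexp_inner_add_paleyWiener hk hm hℓ 0 t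
  simp only [inner_zero_right, zero_add, map_zero, norm_smul, mul_pow, Real.norm_eq_abs,
    sq_abs] at h
  rw [h]
  simp

lemma integrable_exp_mul_paleyWiener (hμ : IsGaussianWithSqrtCov μ m R)
    (hk : k ∈ closure (range R)) (hm : Measurable ℓ)
    (hℓ : ∀ y, eLpNorm (fun v => ⟪v - m, y⟫ - ℓ v) 2 μ = ENNReal.ofReal ‖R y - k‖) (s : ℝ) :
    Integrable (fun v => Real.exp (s * ℓ v)) μ := by
  have h := integrable_exp_mul_gaussianReal (μ := 0) (v := ‖k‖₊ ^ 2) s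
  rw [← (hμ.hasLaw_paleyWiener hk hm hℓ).map_eq, integrable_map_measure (by fun_prop)
    hm.aemeasurable] at h
  exact h

lemma integral_cexp_mul_exp_paleyWiener (hμ : IsGaussianWithSqrtCov μ m R)
    (hk : k ∈ closure (range R)) (hm : Measurable ℓ)
    (hℓ : ∀ y, eLpNorm (fun v => ⟪v - m, y⟫ - ℓ v) 2 μ = ENNReal.ofReal ‖R y - k‖) (y : H) (s : ℝ) :
    ∫ v, Complex.exp (⟪v - m, y⟫ * Complex.I) * (Real.exp (-s * ℓ v) : ℂ) ∂μ =
      Complex.exp (((-‖R y‖ ^ 2 / 2 + s ^ 2 * ‖k‖ ^ 2 / 2 : ℝ) : ℂ) -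
        ((s * ⟪R y, k⟫ : ℝ) : ℂ) * Complex.I) := by
  -- The regression coefficient of `⟨· - m, y⟩` on `ℓ`; for `k = 0` the quotient is `0` by
  -- convention and both sides vanish.
  have hc : ⟪R y, k⟫ = ⟪R y, k⟫ / ‖k‖ ^ 2 * (‖k‖₊ ^ 2 : ℝ≥0) := by
    by_cases h0 : k = 0
    · simp [h0]
    · have : ‖k‖ ≠ 0 := norm_ne_zero_iff.2 h0
      push_cast
      field_simp
  have key := integral_cexp_add_mul_of_gaussian_pair (P := μ) (X := fun v => ⟪v - m, y⟫) (Y := ℓ)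
    (p := ‖R y‖ ^ 2) (c := ⟪R y, k⟫ / ‖k‖ ^ 2) (r := ‖k‖₊ ^ 2) (by fun_prop) hm.aemeasurable ?_ s
  · rw [key, ← hc]
    simp
  · intro a b
    have h := hμ.integral_cexp_inner_add_paleyWiener hk hm hℓ (a • y) b
    rw [← hc]
    simp only [inner_smul_right, map_smul] at h
    rw [h, norm_add_sq_real]
    congr 1
    simp only [norm_smul, mul_pow, Real.norm_eq_abs, sq_abs, inner_smul_left, inner_smul_right]
    simp
    ring

end IsGaussianWithSqrtCov

end GaussianMeasure

/-! ### The Cameron-Martin formula and the score. -/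

namespace IsGaussianWithSqrtCov

variable {H : Type*} [NormedAddCommGroup H] [InnerProductSpace ℝ H] [CompleteSpace H]
  [MeasurableSpace H] [BorelSpace H] [SecondCountableTopology H]
  {μ : Measure H} [IsProbabilityMeasure μ] {m k : H} {R : H →L[ℝ] H} {ℓ : H → ℝ}

/-- The Cameron-Martin formula. -/
lemma map_sub_smul_eq_withDensity (hμ : IsGaussianWithSqrtCov μ m R)
    (hR : R.IsSymmetric) (hk : k ∈ closure (range R)) (hm : Measurable ℓ)
    (hℓ : ∀ y, eLpNorm (fun v => ⟪v - m, y⟫ - ℓ v) 2 μ = ENNReal.ofReal ‖R y - k‖) (s : ℝ) :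
    μ.map (fun v => v - s • R k) = μ.withDensity fun v =>
      ENNReal.ofReal (Real.exp (-s * ℓ v - s ^ 2 * ‖k‖ ^ 2 / 2)) := by
  have hint : Integrable (fun v => Real.exp (-s * ℓ v - s ^ 2 * ‖k‖ ^ 2 / 2)) μ := by
    simp only [Real.exp_sub]
    exact (hμ.integrable_exp_mul_paleyWiener hk hm hℓ (-s)).div_const _
  -- Finiteness suffices to compare characteristic functions; total mass one is a consequence of the
  -- equality.
  have := isFiniteMeasure_withDensity_ofReal hint.2
  have : IsProbabilityMeasure (μ.map fun v => v - s • R k) :=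
    Measure.isProbabilityMeasure_map (by fun_prop)
  refine Measure.ext_of_charFun (funext fun y => ?_)
  have hin : ⟪R k, y⟫ = ⟪R y, k⟫ := by
    rw [hR.apply_clm, real_inner_comm]
  have e1 : ∀ w : H, Complex.exp (⟪w, y⟫ * Complex.I) =
      Complex.exp (⟪m, y⟫ * Complex.I) * Complex.exp (⟪w - m, y⟫ * Complex.I) := fun w => by
    rw [← Complex.exp_add, inner_sub_left]
    congr 1
    push_cast
    ring
  have lhs : charFun (μ.map fun v => v - s • R k) y =
      Complex.exp (⟪m, y⟫ * Complex.I) * (Complex.exp ((-(s * ⟪R y, k⟫) : ℝ) * Complex.I) *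
        Complex.exp ((-‖R y‖ ^ 2 / 2 : ℝ) : ℂ)) := by
    rw [charFun_apply, integral_map (by fun_prop) (by fun_prop), ← hμ y, ← integral_const_mul,
      ← integral_const_mul]
    refine integral_congr_ae (ae_of_all _ fun v => ?_)
    simp only
    rw [e1, ← Complex.exp_add (_ * _) (⟪v - m, y⟫ * Complex.I), ← hin]
    congr 2
    rw [sub_right_comm, inner_sub_left (v - m), inner_smul_left]
    simp
    ring
  have rhs : charFun (μ.withDensity fun v =>
        ENNReal.ofReal (Real.exp (-s * ℓ v - s ^ 2 * ‖k‖ ^ 2 / 2))) y =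
      Complex.exp (⟪m, y⟫ * Complex.I) * ((Real.exp (-(s ^ 2 * ‖k‖ ^ 2 / 2)) : ℂ) *
        Complex.exp (((-‖R y‖ ^ 2 / 2 + s ^ 2 * ‖k‖ ^ 2 / 2 : ℝ) : ℂ) -
        ((s * ⟪R y, k⟫ : ℝ) : ℂ) * Complex.I)) := by
    rw [charFun_apply, integral_withDensity_eq_integral_toReal_smul (by fun_prop) (by simp),
      ← hμ.integral_cexp_mul_exp_paleyWiener hk hm hℓ, ← integral_const_mul, ← integral_const_mul]
    refine integral_congr_ae (ae_of_all _ fun v => ?_)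
    simp only
    rw [e1, ENNReal.toReal_ofReal (Real.exp_pos _).le, sub_eq_add_neg (-s * ℓ v), Real.exp_add,
      Complex.real_smul]
    push_cast
    ring
  rw [lhs, rhs, Complex.ofReal_exp]
  congr 1
  rw [← Complex.exp_add, ← Complex.exp_add]
  congr 1
  push_cast
  ring

lemma isScore (hμ : IsGaussianWithSqrtCov μ m R)
    (hR : R.IsSymmetric) (hk : k ∈ closure (range R)) (hm : Measurable ℓ) (hmem : MemLp ℓ 2 μ)
    (hℓ : ∀ y, eLpNorm (fun v => ⟪v - m, y⟫ - ℓ v) 2 μ = ENNReal.ofReal ‖R y - k‖) :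
    IsScore μ (R k) fun v => -ℓ v := by
  set r : ℝ := ‖k‖ ^ 2 with hr
  have hr0 : 0 ≤ r := sq_nonneg _
  have hlog : ∀ (v : H) (s : ℝ), HasDerivAt (fun s : ℝ => -s * ℓ v - s ^ 2 * r / 2)
      (-ℓ v - s * r) s := by
    intro v s
    have h1 := ((hasDerivAt_id s).neg.mul_const (ℓ v)).sub
      ((((hasDerivAt_id s).pow 2).mul_const r).div_const 2)
    refine h1.congr_deriv ?_
    simp
    ring
  have hshift := hμ.map_sub_smul_eq_withDensity hR hk hm hℓ
  refine ⟨(hmem.integrable (by norm_num)).neg,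
    ⟨fun s v => Real.exp (-s * ℓ v - s ^ 2 * r / 2), fun s => by fun_prop,
      fun s u => Real.exp_pos _, fun u => by fun_prop, hshift, ae_of_all _ fun v => ?_⟩, ?_⟩
  · simp only [Real.log_exp]
    simpa using hlog v 0
  · intro B hB
    have hreal : ∀ s : ℝ, μ.real ((fun u => u - s • R k) ⁻¹' B) =
        ∫ v in B, Real.exp (-s * ℓ v - s ^ 2 * r / 2) ∂μ := by
      intro s
      rw [← map_measureReal_apply (by fun_prop) hB, hshift, measureReal_def,
        withDensity_apply _ hB, integral_eq_lintegral_of_nonneg_ae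
          (ae_of_all _ fun v => (Real.exp_pos _).le)
          (Measurable.aestronglyMeasurable (by fun_prop))]
    simp only [hreal]
    -- For `|s| < 1` the density is at most `e^{|ℓ|}` and the derivative of its logarithm at most
    -- `|ℓ| + r ≤ (1 + r) e^{|ℓ|}`; the product is controlled by exponential moments of the Gaussian
    -- `ℓ`.
    have hb : Integrable (fun v => (1 + r) * (Real.exp (2 * ℓ v) + Real.exp (-2 * ℓ v))) μ :=
      ((hμ.integrable_exp_mul_paleyWiener hk hm hℓ 2).add
        (hμ.integrable_exp_mul_paleyWiener hk hm hℓ (-2))).const_mul _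
    have key := hasDerivAt_integral_of_dominated_loc_of_deriv_le (μ := μ.restrict B) (x₀ := (0 : ℝ))
      (F := fun s v => Real.exp (-s * ℓ v - s ^ 2 * r / 2))
      (F' := fun s v => Real.exp (-s * ℓ v - s ^ 2 * r / 2) * (-ℓ v - s * r))
      (bound := fun v => (1 + r) * (Real.exp (2 * ℓ v) + Real.exp (-2 * ℓ v)))
      (Metric.ball_mem_nhds 0 one_pos)
      (Eventually.of_forall fun s => Measurable.aestronglyMeasurable (by fun_prop))
      (by simp) (Measurable.aestronglyMeasurable (by fun_prop))
      (ae_of_all _ fun v s hs => ?_) hb.restrict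
      (ae_of_all _ fun v s _ => (hlog v s).exp)
    · simpa using key.2
    · rw [Metric.mem_ball, dist_zero_right, Real.norm_eq_abs] at hs
      rw [norm_mul, Real.norm_of_nonneg (Real.exp_pos _).le, Real.norm_eq_abs]
      have h1 : -s * ℓ v - s ^ 2 * r / 2 ≤ |ℓ v| := by
        have : -s * ℓ v ≤ |ℓ v| := by
          refine (le_abs_self _).trans ?_
          rw [abs_mul, abs_neg]
          exact mul_le_of_le_one_left (abs_nonneg _) hs.le
        have : 0 ≤ s ^ 2 * r / 2 := by positivity
        linarith
      have h2 : |-ℓ v - s * r| ≤ (1 + r) * Real.exp |ℓ v| := by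
        have h3 : |-ℓ v - s * r| ≤ |ℓ v| + r := by
          refine (abs_sub _ _).trans ?_
          rw [abs_neg, abs_mul, abs_of_nonneg hr0]
          gcongr
          exact mul_le_of_le_one_left hr0 hs.le
        have h4 := Real.add_one_le_exp |ℓ v|
        nlinarith [abs_nonneg (ℓ v), mul_nonneg hr0 (abs_nonneg (ℓ v))]
      have h5 : Real.exp |ℓ v| * Real.exp |ℓ v| ≤ Real.exp (2 * ℓ v) + Real.exp (-2 * ℓ v) := by
        rw [← Real.exp_add]
        rcases abs_cases (ℓ v) with ⟨h, _⟩ | ⟨h, _⟩ <;> rw [h]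
        · rw [← two_mul]
          linarith [Real.exp_pos (-2 * ℓ v)]
        · rw [← two_mul, mul_neg, ← neg_mul]
          linarith [Real.exp_pos (2 * ℓ v)]
      calc _ ≤ Real.exp |ℓ v| * ((1 + r) * Real.exp |ℓ v|) :=
            mul_le_mul (Real.exp_le_exp.2 h1) h2 (abs_nonneg _) (Real.exp_pos _).le
        _ = (1 + r) * (Real.exp |ℓ v| * Real.exp |ℓ v|) := by ring
        _ ≤ _ := mul_le_mul_of_nonneg_left h5 (by positivity)

end IsGaussianWithSqrtCov

/-! ### Square root and pseudoinverse of an injective covariance. -/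

section Pinv

variable {H : Type*} [NormedAddCommGroup H] [InnerProductSpace ℝ H]
  {γ R : H →L[ℝ] H}

lemma IsPosSqrt.norm_apply_sq (hR : IsPosSqrt γ R) (y : H) : ‖R y‖ ^ 2 = ⟪γ y, y⟫ := by
  rw [← hR.2, ContinuousLinearMap.comp_apply, hR.1.isSymmetric.apply_clm,
    real_inner_self_eq_norm_sq]

lemma IsPosSqrt.apply_apply (hR : IsPosSqrt γ R) (y : H) : R (R y) = γ y := by
  rw [← hR.2, ContinuousLinearMap.comp_apply]

lemma IsPosSqrt.isSymmetric (hR : IsPosSqrt γ R) : γ.IsSymmetric := fun x y => by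
  change ⟪γ x, y⟫ = ⟪x, γ y⟫
  rw [← hR.apply_apply, ← hR.apply_apply, hR.1.isSymmetric.apply_clm,
    hR.1.isSymmetric.apply_clm]

lemma IsPosSqrt.injective (hR : IsPosSqrt γ R) (hinj : Function.Injective γ) :
    Function.Injective R := by
  refine Function.Injective.of_comp (f := R) ?_
  rwa [← ContinuousLinearMap.coe_comp, hR.2]

/-- If `x` is orthogonal to the range, then `0 = ⟨A (A x), x⟩ = ‖A x‖²`. -/
lemma orthogonal_range_eq_bot {A : H →L[ℝ] H} (hA : A.IsSymmetric) (hinj : Function.Injective A) :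
    A.rangeᗮ = ⊥ := by
  refine (Submodule.eq_bot_iff _).2 fun x hx => hinj ?_
  have h : ⟪A (A x), x⟫ = 0 := hx _ ⟨A x, rfl⟩
  rw [hA.apply_clm, inner_self_eq_zero] at h
  rw [h, map_zero]

lemma apply_mem_domain_pinv (hinj : Function.Injective γ) (y : H) : γ y ∈ (pinv γ).domain := by
  refine LinearPMap.mem_domain_of_mem_graph (y := y) ((mem_graph_pinv γ _ _).2 ⟨?_, by simp⟩)
  rw [LinearMap.ker_eq_bot.2 hinj, Submodule.bot_orthogonal_eq_top]
  trivial

lemma apply_pinv (hγ : γ.IsSymmetric) (hinj : Function.Injective γ) (x : (pinv γ).domain) :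
    γ (pinv γ x) = x := by
  have h := ((mem_graph_pinv γ x (pinv γ x)).1 (LinearPMap.mem_graph _ x)).2
  rw [orthogonal_range_eq_bot hγ hinj, Submodule.mem_bot, sub_eq_zero] at h
  exact h.symm

variable [CompleteSpace H]

lemma denseRange_of_isSymmetric {A : H →L[ℝ] H} (hA : A.IsSymmetric)
    (hinj : Function.Injective A) : DenseRange A := by
  have h := (Submodule.topologicalClosure_eq_top_iff (K := A.range)).2
    (orthogonal_range_eq_bot hA hinj)
  have h2 := (Submodule.dense_iff_topologicalClosure_eq_top).2 h
  exact h2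

/-- Convergence of `γ y n` to `h = R k` in the Cameron-Martin norm amounts to `R (y n) → k`. -/
lemma CMTendsto.tendsto_sqrt (hR : IsPosSqrt γ R) (hinj : Function.Injective γ) {y : ℕ → H} {k : H}
    (h : CMTendsto γ (fun n => γ (y n)) (R k)) : Tendsto (fun n => R (y n)) atTop (𝓝 k) := by
  obtain ⟨R', kn, k', hR', hkn, hk', hlim⟩ := h
  have hkn' : ∀ n, kn n = R' (y n) := fun n =>
    hR'.injective hinj ((hkn n).trans (hR'.apply_apply _).symm)
  obtain rfl : kn = fun n => R' (y n) := funext hkn'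
  -- `CMTendsto` supplies its own square root `R'`. Equality of norms transfers the Cauchy property
  -- to `R`, and injectivity of `R` then identifies the limit, so uniqueness of the square root is
  -- not needed.
  have hnorm : ∀ z, ‖R z‖ = ‖R' z‖ := fun z => by
    rw [← pow_left_inj₀ (norm_nonneg _) (norm_nonneg _) two_ne_zero, hR.norm_apply_sq,
      hR'.norm_apply_sq]
  have hcauchy : CauchySeq fun n => R (y n) := by
    refine Metric.cauchySeq_iff'.2 fun ε hε => ?_
    obtain ⟨N, hN⟩ := Metric.cauchySeq_iff'.1 hlim.cauchySeq ε hε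
    refine ⟨N, fun n hn => ?_⟩
    have := hN n hn
    rwa [dist_eq_norm, ← map_sub, hnorm, map_sub, ← dist_eq_norm]
  obtain ⟨k'', hk''⟩ := cauchySeq_tendsto_of_complete hcauchy
  have e1 : Tendsto (fun n => γ (y n)) atTop (𝓝 (R k'')) := by
    simpa only [Function.comp_def, hR.apply_apply] using (R.continuous.tendsto k'').comp hk''
  have e2 : Tendsto (fun n => γ (y n)) atTop (𝓝 (R k)) := by
    have := (R'.continuous.tendsto k').comp hlim
    simpa only [Function.comp_def, hkn, hk'] using this
  rwa [← hR.injective hinj (tendsto_nhds_unique e1 e2)]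

variable [MeasurableSpace H] [BorelSpace H] [SecondCountableTopology H]

theorem IsGaussianWithSqrtCov.exists_pinvPairing_score {μ : Measure H} [IsProbabilityMeasure μ]
    {m : H} (hμ : IsGaussianWithSqrtCov μ m R) (hR : IsPosSqrt γ R)
    (hinj : Function.Injective γ) {h : H} (hh : h ∈ R.range) :
    ∃ ℓ : H → ℝ, IsPinvPairing γ μ m h ℓ ∧ IsScore μ h (fun v => -ℓ v) ∧
      (∀ hh : h ∈ (pinv γ).domain, ∀ᵐ v ∂μ, -ℓ v = -⟪v - m, pinv γ ⟨h, hh⟩⟫) ∧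
      (∀ᵐ v ∂μ, ∀ hv : v - m ∈ (pinv γ).domain, -ℓ v = -⟪pinv γ ⟨v - m, hv⟩, h⟫) := by
  obtain ⟨k, rfl⟩ := hh
  change ∃ ℓ : H → ℝ, IsPinvPairing γ μ m (R k) ℓ ∧ IsScore μ (R k) (fun v => -ℓ v) ∧
      (∀ hh : R k ∈ (pinv γ).domain, ∀ᵐ v ∂μ, -ℓ v = -⟪v - m, pinv γ ⟨R k, hh⟩⟫) ∧
      (∀ᵐ v ∂μ, ∀ hv : v - m ∈ (pinv γ).domain, -ℓ v = -⟪pinv γ ⟨v - m, hv⟩, R k⟫)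
  have hRsymm := hR.1.isSymmetric
  have hγsymm := hR.isSymmetric
  have hRinj := hR.injective hinj
  have hk : k ∈ closure (range R) := denseRange_of_isSymmetric hRsymm hRinj k
  obtain ⟨ℓ, hm, hmem, hℓ⟩ := hμ.exists_paleyWiener hk
  have hpair : ∀ hn : ℕ → (pinv γ).domain, CMTendsto γ (fun n => (hn n : H)) (R k) →
      Tendsto (fun n => R (pinv γ (hn n))) atTop (𝓝 k) := fun hn hcm => by
    refine CMTendsto.tendsto_sqrt hR hinj ?_
    simpa only [apply_pinv hγsymm hinj] using hcm
  have happrox : ∃ hn : ℕ → (pinv γ).domain, CMTendsto γ (fun n => (hn n : H)) (R k) := by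
    obtain ⟨x, hx, hxk⟩ := mem_closure_iff_seq_limit.1 hk
    choose y hy using hx
    refine ⟨fun n => ⟨γ (y n), apply_mem_domain_pinv hinj _⟩, R, fun n => R (y n), k, hR,
      fun n => hR.apply_apply _, rfl, ?_⟩
    simpa only [hy] using hxk
  refine ⟨ℓ, ⟨hmem, happrox, fun hn hcm => tendsto_eLpNorm_inner_sub hℓ (hpair hn hcm)⟩,
    hμ.isScore hRsymm hk hm hmem hℓ, fun hh => ?_, ?_⟩
  -- For `y = γ† h` one has `R y = k`, so the distance from `⟨· - m, y⟩` to `ℓ` in `L²(μ)` is zero.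
  · have h1 : R (pinv γ ⟨R k, hh⟩) = k := hRinj (by rw [hR.apply_apply, apply_pinv hγsymm hinj])
    have h2 := hℓ (pinv γ ⟨R k, hh⟩)
    rw [h1, sub_self, norm_zero, ENNReal.ofReal_zero,
      eLpNorm_eq_zero_iff (Measurable.aestronglyMeasurable (by fun_prop)) two_ne_zero] at h2
    filter_upwards [h2] with v hv
    rw [neg_inj, eq_comm, ← sub_eq_zero]
    exact hv
  · obtain ⟨hn, hcm⟩ := happrox
    have hlim := hpair hn hcm
    have hL2 := tendsto_eLpNorm_inner_sub hℓ hlim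
    have hmeas := tendstoInMeasure_of_tendsto_eLpNorm (μ := μ) two_ne_zero
      (f := fun n v => ⟪v - m, pinv γ (hn n)⟫) (g := ℓ)
      (fun n => Measurable.aestronglyMeasurable (by fun_prop)) hm.aestronglyMeasurable hL2
    -- Almost everywhere along a subsequence `⟨v - m, y n⟩ → ℓ v`. If `v - m = γ w`, symmetry moves
    -- `γ` across: the pairing equals `⟨w, R (R (y n))⟩`, which tends to `⟨w, R k⟩`.
    obtain ⟨ns, hns, hae⟩ := hmeas.exists_seq_tendsto_ae
    filter_upwards [hae] with v hv hdom
    rw [neg_inj]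
    refine tendsto_nhds_unique hv ?_
    have e : ∀ n, ⟪v - m, pinv γ (hn n)⟫ = ⟪pinv γ ⟨v - m, hdom⟩, R (R (pinv γ (hn n)))⟫ := by
      intro n
      rw [hR.apply_apply, ← hγsymm.apply_clm, apply_pinv hγsymm hinj]
    simp only [e]
    exact tendsto_const_nhds.inner
      ((R.continuous.tendsto k).comp (hlim.comp hns.tendsto_atTop))

end Pinv

/-! ### The Malliavin derivative of a stochastic integral. -/

section Malliavin

variable {Ω : Type*} [MeasurableSpace Ω] {P : Measure Ω} {ι : Type*}
  {U : Type*} [NormedAddCommGroup U] [InnerProductSpace ℝ U] {f : HilbertBasis ι ℝ U}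

lemma isWienerIntegral_stepFun {E : Type*} [NormedAddCommGroup E] [NormedSpace ℝ E]
    {B : ℝ≥0 → Ω → ℝ} (hB : ∀ t, Measurable (B t)) {T : ℝ≥0} (n : ℕ) {t : ℕ → ℝ≥0}
    (ht : Monotone t) (hT : ∀ i, t i ≤ T) (a : ℕ → E) :
    IsWienerIntegral P B T (stepFun n t a) (stepIntegral B n t a) :=
  ⟨memLp_stepFun _ _ _ _ _, (measurable_stepIntegral hB _ _ _).aestronglyMeasurable,
    fun _ => n, fun _ => t, fun _ => a, fun _ => ⟨ht, hT⟩, by simp, by simp⟩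

lemma inner_indicator_basis [DecidableEq ι] (k j : ι) (s : Set ℝ) (r : ℝ) :
    ⟪s.indicator (fun _ => f k) r, f j⟫ = if k = j then s.indicator (fun _ => (1 : ℝ)) r else 0 := by
  have h := orthonormal_iff_ite.1 f.orthonormal k j
  by_cases hr : r ∈ s <;> simp [hr, h]

lemma isStochasticIntegral_indicator_basis {B : ι → ℝ≥0 → Ω → ℝ} (hB : ∀ k t, Measurable (B k t))
    {T a b : ℝ≥0} (hab : a ≤ b) (hb : b ≤ T) (k : ι) :
    IsStochasticIntegral P f B T
      (fun s => innerSL ℝ ((Ioc (a : ℝ) b).indicator (fun _ => f k) s))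
      (fun ω => B k b ω - B k a ω) := by
  classical
  -- A one-interval partition. Only coordinate `k` contributes, so the partial sums are exact once
  -- `F` contains `k`.
  let t : ℕ → ℝ≥0 := fun i => if i = 0 then a else b
  have ht : Monotone t := monotone_nat_of_le_succ fun i => by
    by_cases hi : i = 0 <;> simp [t, hi, hab]
  have htT : ∀ i, t i ≤ T := fun i => by
    by_cases hi : i = 0 <;> simp [t, hi, hb, hab.trans hb]
  have e1 : ∀ j, (fun s => innerSL ℝ ((Ioc (a : ℝ) b).indicator (fun _ => f k) s) (f j)) =
      stepFun 1 t fun _ => if k = j then (1 : ℝ) else 0 := fun j => by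
    ext s
    rw [innerSL_apply_apply, inner_indicator_basis]
    by_cases hj : k = j <;> simp [stepFun, t, hj]
  refine ⟨((hB k b).sub (hB k a)).aestronglyMeasurable,
    fun j => stepIntegral (B j) 1 t fun _ => if k = j then (1 : ℝ) else 0, fun j => ?_, ?_⟩
  · rw [e1]
    exact isWienerIntegral_stepFun (hB j) 1 ht htT _
  · refine tendsto_const_nhds.congr' ?_
    filter_upwards [eventually_ge_atTop {k}] with F hF
    have hk : k ∈ F := hF (Finset.mem_singleton_self k)
    have : (fun ω => B k b ω - B k a ω -
        ∑ j ∈ F, stepIntegral (B j) 1 t (fun _ => if k = j then (1 : ℝ) else 0) ω) = 0 := by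
      ext ω
      simp [stepIntegral, t, hk]
    rw [this, eLpNorm_zero]

variable {H : Type*} [NormedAddCommGroup H] [InnerProductSpace ℝ H]

lemma isSmoothCylindrical_affine {B : ι → ℝ≥0 → Ω → ℝ} {T : ℝ≥0} {K : Type*} [Fintype K] (x₀ : H)
    {g : K → ℝ → U} {W : K → Ω → ℝ} (hg : ∀ κ, MemLp (g κ) 2 (volume.restrict (Ioc (0 : ℝ) T)))
    (hW : ∀ κ, IsStochasticIntegral P f B T (fun s => innerSL ℝ (g κ s)) (W κ)) (x : K → H) :
    IsSmoothCylindrical P f B T (fun ω => x₀ + ∑ κ, W κ ω • x κ)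
      (fun r _ => ∑ κ, (innerSL ℝ (g κ r)).smulRight (x κ)) := by
  let e := Fintype.equivFin K
  refine ⟨Fintype.card K, Fintype.card K + 1, fun j => g (e.symm j), fun j => W (e.symm j),
    -- Index `0` carries the constant `x₀`, whose derivative vanishes; the other indices carry
    -- coordinate projections.
    Fin.cons (fun _ => 1) fun j y => y j, Fin.cons x₀ fun j => x (e.symm j), fun _ => hg _,
    fun _ => hW _, fun i => ?_, fun ω => ?_, fun r ω => ?_⟩
  · refine Fin.cases ?_ (fun j => ?_) i
    · exact Function.HasTemperateGrowth.const (1 : ℝ)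
    · simp only [Fin.cons_succ]
      exact (ContinuousLinearMap.proj (R := ℝ) (φ := fun _ : Fin (Fintype.card K) => ℝ)
        j).hasTemperateGrowth
  · rw [Fin.sum_univ_succ]
    simp only [Fin.cons_zero, Fin.cons_succ, one_smul]
    rw [e.symm.sum_comp fun κ => W κ ω • x κ]
  · rw [Fin.sum_univ_succ]
    simp only [Fin.cons_zero, Fin.cons_succ]
    have h1 : ∀ (j : Fin (Fintype.card K)) (y : Fin (Fintype.card K) → ℝ),
        fderiv ℝ (fun y : Fin (Fintype.card K) → ℝ => y j) y = ContinuousLinearMap.proj j :=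
      fun j y => (ContinuousLinearMap.proj (R := ℝ) (φ := fun _ : Fin (Fintype.card K) => ℝ)
        j).fderiv
    simp only [h1]
    rw [← e.symm.sum_comp fun κ => (innerSL ℝ (g κ r)).smulRight (x κ)]
    ext z
    simp

/-- The integrand `r ↦ ∑ k ∈ F, φ k r ⊗ f k`, for step functions `φ k`, as it appears in the
Malliavin derivative of the integral. -/
noncomputable def stepOp (f : HilbertBasis ι ℝ U) (F : Finset ι) (n : ι → ℕ) (t : ι → ℕ → ℝ≥0)
    (a : ι → ℕ → H)
    (r : ℝ) : U →L[ℝ] H :=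
  ∑ κ : (Σ k : F, Fin (n k)),
    (innerSL ℝ ((Ioc (t κ.1 κ.2 : ℝ) (t κ.1 (κ.2 + 1))).indicator (fun _ => f κ.1) r)).smulRight
      (a κ.1 κ.2)

/-- Reduces the Hilbert-Schmidt error to one `L²` error per basis vector. -/
lemma stepOp_apply_basis [DecidableEq ι] (F : Finset ι) (n : ι → ℕ) (t : ι → ℕ → ℝ≥0)
    (a : ι → ℕ → H) (r : ℝ) (j : ι) :
    stepOp f F n t a r (f j) = if j ∈ F then stepFun (n j) (t j) (a j) r else 0 := by
  have h1 : stepOp f F n t a r (f j) = ∑ k : F, ∑ i : Fin (n k), if (k : ι) = j then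
      (Ioc (t k i : ℝ) (t k (i + 1))).indicator (fun _ => a k i) r else 0 := by
    rw [← Fintype.sum_sigma', stepOp, sum_apply]
    refine Finset.sum_congr rfl fun κ _ => ?_
    rw [ContinuousLinearMap.smulRight_apply, innerSL_apply_apply, inner_indicator_basis]
    by_cases hk : (κ.1 : ι) = j
    · by_cases hr : r ∈ Ioc (t κ.1 κ.2 : ℝ) (t κ.1 (κ.2 + 1)) <;> simp_all
    · simp [hk]
  rw [h1, Finset.sum_coe_sort F fun k => ∑ i : Fin (n k), if k = j then
      (Ioc (t k i : ℝ) (t k (i + 1))).indicator (fun _ => a k i) r else 0]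
  by_cases hj : j ∈ F
  · rw [if_pos hj, Finset.sum_eq_single_of_mem j hj fun k _ hk => by simp [hk]]
    simp [stepFun, Finset.sum_range]
  · rw [if_neg hj]
    refine Finset.sum_eq_zero fun k hk => ?_
    have : k ≠ j := fun h => hj (h ▸ hk)
    simp [this]

lemma isSmoothCylindrical_sum_stepIntegral {B : ι → ℝ≥0 → Ω → ℝ}
    (hB : ∀ k t, Measurable (B k t)) {T : ℝ≥0} (x₀ : H) (F : Finset ι) (n : ι → ℕ)
    {t : ι → ℕ → ℝ≥0} (ht : ∀ k, Monotone (t k)) (hT : ∀ k i, t k i ≤ T) (a : ι → ℕ → H) :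
    IsSmoothCylindrical P f B T
      (fun ω => x₀ + ∑ k ∈ F, stepIntegral (B k) (n k) (t k) (a k) ω)
      (fun r _ => stepOp f F n t a r) := by
  have h := isSmoothCylindrical_affine (P := P) (f := f) (B := B) (T := T) x₀
    (K := Σ k : F, Fin (n k))
    (g := fun κ => (Ioc (t κ.1 κ.2 : ℝ) (t κ.1 (κ.2 + 1))).indicator (fun _ => f κ.1))
    (W := fun κ ω => B κ.1 (t κ.1 (κ.2 + 1)) ω - B κ.1 (t κ.1 κ.2) ω)
    (fun κ => (memLp_indicator_const 2 measurableSet_Ioc _ (Or.inr (by simp))).restrict _)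
    (fun κ => isStochasticIntegral_indicator_basis hB (ht _ (Nat.le_succ _)) (hT _ _) _)
    (fun κ => a κ.1 κ.2)
  have e : ∀ ω, ∑ k ∈ F, stepIntegral (B k) (n k) (t k) (a k) ω = ∑ κ : (Σ k : F, Fin (n k)),
      (B κ.1 (t κ.1 (κ.2 + 1)) ω - B κ.1 (t κ.1 κ.2) ω) • a κ.1 κ.2 := fun ω => by
    rw [Fintype.sum_sigma, ← Finset.sum_coe_sort]
    refine Finset.sum_congr rfl fun k _ => ?_
    rw [stepIntegral, Finset.sum_range]
  simp only [e]
  exact h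

lemma lintegral_enorm_sq_eq_eLpNorm_sq {α E : Type*} [MeasurableSpace α] {μ : Measure α}
    [NormedAddCommGroup E] (φ : α → E) : ∫⁻ x, ‖φ x‖ₑ ^ 2 ∂μ = eLpNorm φ 2 μ ^ 2 := by
  rw [eLpNorm_eq_lintegral_rpow_enorm_toReal two_ne_zero ENNReal.ofNat_ne_top,
    ← ENNReal.rpow_natCast, ← ENNReal.rpow_mul]
  simp

theorem IsStochasticIntegral.isMalliavinDerivative [IsProbabilityMeasure P] [Countable ι]
    {B : ι → ℝ≥0 → Ω → ℝ} (hB : ∀ k t, Measurable (B k t)) {T : ℝ≥0} {Φ : ℝ → U →L[ℝ] H}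
    {X : Ω → H} (hX : IsStochasticIntegral P f B T Φ X) (hΦ : ∀ k, Continuous fun r => Φ r (f k))
    (hsum : ∑' k, ∫⁻ r in Ioc (0 : ℝ) T, ‖Φ r (f k)‖ₑ ^ 2 ≠ ∞) (x₀ : H) :
    IsMalliavinDerivative P f B T (fun ω => x₀ + X ω) (fun r _ => Φ r) := by
  classical
  obtain ⟨hXm, I, hI, hlim⟩ := hX
  refine ⟨aestronglyMeasurable_const.add hXm, fun k =>
    ((hΦ k).stronglyMeasurable.comp_measurable measurable_snd).aestronglyMeasurable, ?_⟩
  choose hφ hIm n t a ht hst hint using hI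
  have hJm : ∀ k m, AEStronglyMeasurable (stepIntegral (B k) (n k m) (t k m) (a k m)) P :=
    fun k m => (measurable_stepIntegral (hB k) _ _ _).aestronglyMeasurable
  have herr1 : ∀ (F : Finset ι) (m : ℕ),
      eLpNorm (fun ω => x₀ + ∑ k ∈ F, stepIntegral (B k) (n k m) (t k m) (a k m) ω - (x₀ + X ω))
        2 P ≤
      ∑ k ∈ F, eLpNorm (fun ω => I k ω - stepIntegral (B k) (n k m) (t k m) (a k m) ω) 2 P +
        eLpNorm (fun ω => X ω - ∑ k ∈ F, I k ω) 2 P := by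
    intro F m
    rw [← eLpNorm_neg]
    have e : (-fun ω => x₀ + ∑ k ∈ F, stepIntegral (B k) (n k m) (t k m) (a k m) ω - (x₀ + X ω)) =
        (∑ k ∈ F, fun ω => I k ω - stepIntegral (B k) (n k m) (t k m) (a k m) ω) +
          fun ω => X ω - ∑ k ∈ F, I k ω := by
      ext ω
      simp only [Pi.neg_apply, Pi.add_apply, Finset.sum_apply, Finset.sum_sub_distrib]
      abel
    rw [e]
    refine (eLpNorm_add_le (Finset.aestronglyMeasurable_sum _ fun k _ => (hIm k).sub (hJm k m))
      (hXm.sub (Finset.aestronglyMeasurable_fun_sum _ fun k _ => hIm k)) (by norm_num)).trans ?_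
    exact add_le_add (eLpNorm_sum_le (fun k _ => (hIm k).sub (hJm k m)) (by norm_num)) le_rfl
  -- The derivative error is exactly the step approximation error on `F` plus the Hilbert-Schmidt
  -- tail off `F`.
  have herr2 : ∀ (F : Finset ι) (m : ℕ),
      ∫⁻ _, (∫⁻ r in Ioc (0 : ℝ) T, ∑' k, ‖stepOp f F (fun k => n k m) (fun k => t k m)
        (fun k => a k m) r (f k) - Φ r (f k)‖ₑ ^ 2) ∂P =
      ∑ k ∈ F, eLpNorm (fun s => Φ s (f k) - stepFun (n k m) (t k m) (a k m) s) 2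
        (volume.restrict (Ioc (0 : ℝ) T)) ^ 2 +
      ∑' k : {k // k ∉ F}, ∫⁻ r in Ioc (0 : ℝ) T, ‖Φ r (f k)‖ₑ ^ 2 := by
    intro F m
    simp only [lintegral_const, measure_univ, mul_one, stepOp_apply_basis]
    rw [lintegral_tsum]
    · rw [← ENNReal.sum_add_tsum_compl F]
      refine congrArg₂ _ (Finset.sum_congr rfl fun k hk => ?_) ?_
      · rw [← lintegral_enorm_sq_eq_eLpNorm_sq]
        refine lintegral_congr fun r => ?_
        rw [if_pos hk, ← enorm_neg, neg_sub]
      · refine tsum_congr fun k => lintegral_congr fun r => ?_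
        rw [if_neg (by exact k.2), zero_sub, enorm_neg]
    · intro k
      by_cases hk : k ∈ F
      · simp only [if_pos hk]
        exact (((measurable_stepFun _ _ _).sub (hΦ k).stronglyMeasurable).enorm.pow_const
          2).aemeasurable
      · simp only [if_neg hk, zero_sub, enorm_neg]
        exact ((hΦ k).stronglyMeasurable.enorm.pow_const 2).aemeasurable
  have htail := ENNReal.tendsto_tsum_compl_atTop_zero hsum
  have hex : ∀ N : ℕ, ∃ (F : Finset ι) (m : ℕ),
      eLpNorm (fun ω => x₀ + ∑ k ∈ F, stepIntegral (B k) (n k m) (t k m) (a k m) ω - (x₀ + X ω))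
        2 P ≤ ((N : ℝ≥0∞) + 1)⁻¹ + ((N : ℝ≥0∞) + 1)⁻¹ ∧
      ∫⁻ _, (∫⁻ r in Ioc (0 : ℝ) T, ∑' k, ‖stepOp f F (fun k => n k m) (fun k => t k m)
        (fun k => a k m) r (f k) - Φ r (f k)‖ₑ ^ 2) ∂P ≤
        ((N : ℝ≥0∞) + 1)⁻¹ + ((N : ℝ≥0∞) + 1)⁻¹ := by
    intro N
    have hε : (0 : ℝ≥0∞) < ((N : ℝ≥0∞) + 1)⁻¹ := ENNReal.inv_pos.2 (by finiteness)
    -- `F` is fixed first to make both tails small; `m` is then chosen for the finitely many step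
    -- approximations in `F`.
    obtain ⟨F, hF1, hF2⟩ := ((hlim.eventually_le_const hε).and
      (htail.eventually_le_const hε)).exists
    have l1 : Tendsto (fun m => ∑ k ∈ F,
        eLpNorm (fun ω => I k ω - stepIntegral (B k) (n k m) (t k m) (a k m) ω) 2 P) atTop
        (𝓝 (∑ k ∈ F, 0)) := tendsto_finsetSum _ fun k _ => hint k
    have l2 : Tendsto (fun m => ∑ k ∈ F,
        eLpNorm (fun s => Φ s (f k) - stepFun (n k m) (t k m) (a k m) s) 2
        (volume.restrict (Ioc (0 : ℝ) T)) ^ 2) atTop (𝓝 (∑ k ∈ F, 0 ^ 2)) :=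
      tendsto_finsetSum _ fun k _ => (ENNReal.continuous_pow 2).tendsto _ |>.comp (hst k)
    simp only [Finset.sum_const_zero, ne_eq, two_ne_zero, not_false_eq_true, zero_pow] at l1 l2
    obtain ⟨m, hm1, hm2⟩ := ((l1.eventually_le_const hε).and (l2.eventually_le_const hε)).exists
    refine ⟨F, m, (herr1 F m).trans (add_le_add hm1 hF1), ?_⟩
    rw [herr2]
    exact add_le_add hm2 hF2
  choose F m h1 h2 using hex
  have hε : Tendsto (fun N : ℕ => ((N : ℝ≥0∞) + 1)⁻¹ + ((N : ℝ≥0∞) + 1)⁻¹) atTop (𝓝 0) := by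
    have h : Tendsto (fun N : ℕ => ((N : ℝ≥0∞) + 1)⁻¹) atTop (𝓝 0) := by
      have := (tendsto_add_atTop_iff_nat 1).2 ENNReal.tendsto_inv_nat_nhds_zero
      simpa using this
    simpa using h.add h
  refine ⟨fun N ω => x₀ + ∑ k ∈ F N, stepIntegral (B k) (n k (m N)) (t k (m N)) (a k (m N)) ω,
    fun N r _ => stepOp f (F N) (fun k => n k (m N)) (fun k => t k (m N)) (fun k => a k (m N)) r,
    fun N => isSmoothCylindrical_sum_stepIntegral hB x₀ (F N) _ (fun k => (ht k (m N)).1)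
      (fun k => (ht k (m N)).2) _, ?_, ?_⟩
  · exact tendsto_of_tendsto_of_tendsto_of_le_of_le tendsto_const_nhds hε (fun _ => zero_le) h1
  · exact tendsto_of_tendsto_of_tendsto_of_le_of_le tendsto_const_nhds hε (fun _ => zero_le) h2

lemma IsMalliavinDerivative.congr {B : ι → ℝ≥0 → Ω → ℝ} {T : ℝ≥0} {X Y : Ω → H}
    {D : ℝ → Ω → U →L[ℝ] H} (h : IsMalliavinDerivative P f B T X D) (hXY : X =ᵐ[P] Y) :
    IsMalliavinDerivative P f B T Y D := by
  obtain ⟨h1, h2, Fn, DFn, h3, h4, h5⟩ := h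
  refine ⟨h1.congr hXY, h2, Fn, DFn, h3, h4.congr fun n => eLpNorm_congr_ae ?_, h5⟩
  filter_upwards [hXY] with ω hω
  rw [hω]

end Malliavin

/-- Distinct basis vectors are `√2` apart, so the balls of radius `1/2` around them are disjoint,
and a separable space contains only countably many such balls. -/
lemma countable_of_hilbertBasis {ι U : Type*} [NormedAddCommGroup U] [InnerProductSpace ℝ U]
    [TopologicalSpace.SeparableSpace U] (f : HilbertBasis ι ℝ U) : Countable ι := by
  refine Pairwise.countable_of_isOpen_disjoint (s := fun k => Metric.ball (f k) (1 / 2))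
    (fun j k hjk => Metric.ball_disjoint_ball ?_) (fun k => Metric.isOpen_ball)
    (fun k => Metric.nonempty_ball.2 (by norm_num))
  have h : dist (f j) (f k) ^ 2 = 2 := by
    rw [dist_eq_norm, norm_sub_sq_real, f.orthonormal.2 hjk, f.orthonormal.1 j, f.orthonormal.1 k]
    norm_num
  nlinarith [dist_nonneg (x := f j) (y := f k)]

/-! ### Bounds for the convolution integrand. -/

section Convolution

variable {ι : Type*}
  {U : Type*} [NormedAddCommGroup U] [InnerProductSpace ℝ U]
  {H : Type*} [NormedAddCommGroup H] [InnerProductSpace ℝ H]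

lemma norm_sq_semigroup_comp_le {S : ℝ≥0 → H →L[ℝ] H} {M ω : ℝ} (hM : 0 ≤ M)
    (hb : ∀ (t : ℝ≥0) (x : H), ‖S t x‖ ≤ M * Real.exp (ω * t) * ‖x‖)
    (G : U →L[ℝ] H) {t T : ℝ≥0} (ht : t ≤ T) (z : U) :
    ‖(S t).comp G z‖ ^ 2 ≤ (M * Real.exp (|ω| * T)) ^ 2 * ‖G z‖ ^ 2 := by
  rw [← mul_pow]
  exact pow_le_pow_left₀ (norm_nonneg _) (norm_semigroup_apply_le_of_le hM hb ht (G z)) 2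

lemma tsum_lintegral_enorm_sq_ne_top {E : Type*} [NormedAddCommGroup E] {b : ι → ℝ}
    (hbs : Summable b) {T : ℝ≥0} {φ : ι → ℝ → E}
    (hb : ∀ k r, ‖φ k r‖ ^ 2 ≤ b k) :
    ∑' k, ∫⁻ r in Ioc (0 : ℝ) T, ‖φ k r‖ₑ ^ 2 ≠ ∞ := by
  have h1 : ∀ k, ∫⁻ r in Ioc (0 : ℝ) T, ‖φ k r‖ₑ ^ 2 ≤ ENNReal.ofReal (b k) * T := fun k => by
    refine (lintegral_mono (g := fun _ => ENNReal.ofReal (b k)) fun r => ?_).trans ?_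
    · rw [← ofReal_norm, ← ENNReal.ofReal_pow (norm_nonneg _)]
      exact ENNReal.ofReal_le_ofReal (hb k r)
    · simp
  refine ne_top_of_le_ne_top ?_ (ENNReal.tsum_le_tsum h1)
  rw [ENNReal.tsum_mul_right]
  exact ENNReal.mul_ne_top hbs.tsum_ofReal_ne_top ENNReal.coe_ne_top

end Convolution

end LinearSPDE

theorem theorem5
    {H : Type*} [NormedAddCommGroup H] [InnerProductSpace ℝ H] [CompleteSpace H]
    [TopologicalSpace.SeparableSpace H] [MeasurableSpace H] [BorelSpace H]
    {U : Type*} [NormedAddCommGroup U] [InnerProductSpace ℝ U] [CompleteSpace U]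
    [TopologicalSpace.SeparableSpace U]
    {Ω : Type*} [MeasurableSpace Ω] (P : Measure Ω) [IsProbabilityMeasure P]
    -- the generator, its semigroup and the growth bound
    (A : H →ₗ.[ℝ] H) (hA : Dense (A.domain : Set H))
    (S : ℝ≥0 → H →L[ℝ] H) (hS : LinearSPDE.IsC0Semigroup S) (hAS : LinearSPDE.IsGenerator A S)
    (M ω₀ : ℝ) (hM : 1 ≤ M) (hbound : ∀ (t : ℝ≥0) (x : H), ‖S t x‖ ≤ M * Real.exp (ω₀ * t) * ‖x‖)
    -- the cylindrical Wiener process on `U`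
    {ι : Type*} (f : HilbertBasis ι ℝ U) (B : ι → ℝ≥0 → Ω → ℝ)
    (hB : LinearSPDE.IsCylindricalWiener P B)
    -- the Hilbert-Schmidt operator `G = Q^{1/2}`
    (G : U →L[ℝ] H) (hG : Summable fun k => ‖G (f k)‖ ^ 2)
    -- the mild solution
    (u₀ : H) (u : ℝ≥0 → Ω → H) (hu : LinearSPDE.IsMildSolution P f B S G u₀ u)
    (T : ℝ≥0) (hT : 0 < T)
    (γ : H →L[ℝ] H) (hγ : γ = LinearSPDE.covOp S G T) (hinj : Function.Injective γ) :
    -- `γ` is the Malliavin covariance operator of `u(T)`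
    (LinearSPDE.IsMalliavinDerivative P f B T (u T)
        (fun r _ => (S (T - r.toNNReal)).comp G) ∧
      γ = LinearSPDE.malliavinCov T (fun r => (S (T - r.toNNReal)).comp G)) ∧
    -- the score of the law of `u(T)` along the directions in the range of `γ^{1/2}`
    ∀ R : H →L[ℝ] H, LinearSPDE.IsPosSqrt γ R → ∀ h ∈ R.range,
      ∃ ℓ : H → ℝ,
        LinearSPDE.IsPinvPairing γ (P.map (u T)) (S T u₀) h ℓ ∧
        LinearSPDE.IsScore (P.map (u T)) h (fun v => -ℓ v) ∧
        (∀ hh : h ∈ (LinearSPDE.pinv γ).domain, ∀ᵐ v ∂(P.map (u T)),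
          -ℓ v = -⟪v - S T u₀, LinearSPDE.pinv γ ⟨h, hh⟩⟫) ∧
        (∀ᵐ v ∂(P.map (u T)), ∀ hv : v - S T u₀ ∈ (LinearSPDE.pinv γ).domain,
          -ℓ v = -⟪LinearSPDE.pinv γ ⟨v - S T u₀, hv⟩, h⟫) := by
  have hM0 : 0 ≤ M := zero_le_one.trans hM
  have : Countable ι := LinearSPDE.countable_of_hilbertBasis f
  have hDcont : Continuous fun r : ℝ => (S (T - r.toNNReal)).comp G :=
    (LinearSPDE.continuous_semigroup_comp f hS hM0 hbound G hG).comp (by fun_prop)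
  have hDbound : ∀ (r : ℝ) k, ‖(S (T - r.toNNReal)).comp G (f k)‖ ^ 2 ≤
      (M * Real.exp (|ω₀| * T)) ^ 2 * ‖G (f k)‖ ^ 2 := fun r k =>
    -- Truncated subtraction keeps `T - r.toNNReal` below `T` for every real `r`, so the bound is
    -- global.
    LinearSPDE.norm_sq_semigroup_comp_le hM0 hbound G tsub_le_self _
  have hDsum := hG.mul_left ((M * Real.exp (|ω₀| * T)) ^ 2)
  have hγ' := hγ.trans (LinearSPDE.covOp_eq_malliavinCov S G T)
  obtain ⟨X, hX, huX⟩ := hu T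
  have huX' : (fun ω => S T u₀ + X ω) =ᵐ[P] u T := huX.mono fun ω hω => hω.symm
  refine ⟨⟨?_, hγ'⟩, fun R hR h hh => ?_⟩
  · exact (hX.isMalliavinDerivative hB.measurable (fun k => hDcont.clm_apply continuous_const)
      (LinearSPDE.tsum_lintegral_enorm_sq_ne_top hDsum fun k r => hDbound r k) (S T u₀)).congr huX'
  · have hum : AEMeasurable (u T) P :=
      ((aestronglyMeasurable_const.add hX.1).congr huX').aemeasurable
    have := Measure.isProbabilityMeasure_map (μ := P) hum
    -- The functional `⟨y, ·⟩` turns `X` into a real stochastic integral of variance `⟨γ y, y⟩ = ‖R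
    -- y‖²`.
    have hgauss : LinearSPDE.IsGaussianWithSqrtCov (P.map (u T)) (S T u₀) R := fun y => by
      have hσ := LinearSPDE.hasSum_integral_sq_inner_malliavinCov f hDcont T hDbound hDsum y
      rw [← hγ'] at hσ
      rw [integral_map hum (Continuous.aestronglyMeasurable (by fun_prop)), hR.norm_apply_sq,
        ← (hX.clm_comp (innerSL ℝ y)).integral_cexp hB (σ := ⟪γ y, y⟫) ?_]
      · refine integral_congr_ae ?_
        filter_upwards [huX] with ω hω
        rw [hω, add_sub_cancel_left, innerSL_apply_apply, real_inner_comm]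
      · simpa only [ContinuousLinearMap.comp_apply, innerSL_apply_apply, real_inner_comm y] using hσ
    exact hgauss.exists_pinvPairing_score hR hinj hh
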